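/- Let $m,\mu\in\mathbb R$. Let $\sigma_1,\sigma_2,\sigma_3$ be the Pauli matrices, $\alpha_j=\begin{pmatrix}0&\sigma_j\\ \sigma_j&0\end{pmatrix}$ ($j=1,2,3$), $\beta=\begin{pmatrix}\mathbb I_2&0\\0&-\mathbb I_2\end{pmatrix}$, and consider on $\mathbb R^3$ the Dirac expression with Lorentz-scalar potential $$H=-i\,\alpha\cdot\nabla+m\beta+\frac{\mu}{|x|}\,\beta .$$ In the Hilbert space $L^2(\mathbb R^3)^4=L^2(\mathbb R^3;\mathbb C^4)$, let $T_{min}$ be the operator $\varphi\mapsto H\varphi$ with domain $C_c^\infty(\mathbb R^3)^4$, let $\mathring T_{min}$ be its restriction to $C_c^\infty(\mathbb R^3\setminus\{0\})^4$, and let $T_{max}$ be the operator with domain $$\mathcal D(T_{max})=\{\psi\in L^2(\mathbb R^3)^4:\ H\psi\in L^2(\mathbb R^3)^4\},\qquad T_{max}\psi=H\psi,$$ where $H\psi=\eta\in L^2(\mathbb R^3)^4$ is understood in the distributional sense, that is, $\int \langle H\varphi,\psi\rangle_{\mathbb C^4}\,dx=\int\langle \varphi,\eta\rangle_{\mathbb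 C^4}\,dx$ for all $\varphi\in C_c^\infty(\mathbb R^3)^4$. A densely defined symmetric operator is called essentially self-adjoint if its closure is self-adjoint. Then $T_{min}$ is essentially self-adjoint, it is already essentially self-adjoint on $C_c^\infty(\mathbb R^3\setminus\{0\})^4$ (that is, $\mathring T_{min}$ is essentially self-adjoint), and $$\mathcal D\bigl(\overline{\mathring T_{min}}\bigr)=\mathcal D\bigl(\overline{T_{min}}\bigr)=\mathcal D(T_{max})=H^1(\mathbb R^3)^4 .$$ -/

import Mathlib

open MeasureTheory
open scoped Distributions SchwartzMap ENNReal ContDiff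

noncomputable section

namespace DiracOp

/-- Physical space `ℝ³` with its Euclidean norm. -/
abbrev Space : Type := EuclideanSpace ℝ (Fin 3)

/-- Spinors: `ℂ⁴` with its Hermitian inner product. -/
abbrev Spinor : Type := EuclideanSpace ℂ (Fin 4)

/-- The Hilbert space `L²(ℝ³)⁴ = L²(ℝ³; ℂ⁴)`, with respect to Lebesgue measure. -/
abbrev L2 : Type := Lp Spinor 2 (volume : Measure Space)

/-- The Pauli matrices `σ₁, σ₂, σ₃`. -/
def pauli : Fin 3 → Matrix (Fin 2) (Fin 2) ℂ :=
  ![!![0, 1; 1, 0], !![0, -Complex.I; Complex.I, 0], !![1, 0; 0, -1]]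

/-- The Dirac matrices `α₁, α₂, α₃`, with block form `(0 σⱼ; σⱼ 0)`. -/
def alpha (j : Fin 3) : Matrix (Fin 4) (Fin 4) ℂ :=
  !![0, 0, pauli j 0 0, pauli j 0 1;
     0, 0, pauli j 1 0, pauli j 1 1;
     pauli j 0 0, pauli j 0 1, 0, 0;
     pauli j 1 0, pauli j 1 1, 0, 0]

/-- The Dirac matrix `β = diag(1, 1, -1, -1)`. -/
def beta : Matrix (Fin 4) (Fin 4) ℂ :=
  !![1, 0, 0, 0; 0, 1, 0, 0; 0, 0, -1, 0; 0, 0, 0, -1]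

/-- `α · v = ∑ⱼ vⱼ αⱼ` for `v ∈ ℝ³`. -/
def alphaDot (v : Space) : Matrix (Fin 4) (Fin 4) ℂ := ∑ j, (v j : ℂ) • alpha j

/-- The matrix potential
`𝕍(x) = |x|⁻¹ (ν 𝕀₄ + μ β + lam (-i α·(x/|x|) β))` for `x ≠ 0` (and `0` at `x = 0`). -/
def potential (ν μ lam : ℝ) (x : Space) : Matrix (Fin 4) (Fin 4) ℂ :=
  ((‖x‖⁻¹ : ℝ) : ℂ) • ((ν : ℂ) • (1 : Matrix (Fin 4) (Fin 4) ℂ) + (μ : ℂ) • beta +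
    (lam : ℂ) • ((-Complex.I) • (alphaDot (‖x‖⁻¹ • x) * beta)))

/-- The `j`-th partial derivative of a spinor field. -/
def partialDeriv (j : Fin 3) (φ : Space → Spinor) (x : Space) : Spinor :=
  fderiv ℝ φ x (EuclideanSpace.single j 1)

/-- The classical action `(Hφ)(x) = -i ∑ⱼ αⱼ ∂ⱼφ(x) + m β φ(x) + 𝕍(x) φ(x)`. -/
def diracFun (m ν μ lam : ℝ) (φ : Space → Spinor) (x : Space) : Spinor :=
  (-Complex.I) • (∑ j, (alpha j).toEuclideanLin (partialDeriv j φ x))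
    + (m : ℂ) • beta.toEuclideanLin (φ x)
    + (potential ν μ lam x).toEuclideanLin (φ x)

variable {Ω : TopologicalSpace.Opens Space}

theorem memLp_testFunction (φ : 𝓓(Ω, Spinor)) : MemLp φ 2 (volume : Measure Space) :=
  φ.continuous.memLp_of_hasCompactSupport φ.hasCompactSupport

theorem memLp_smul_of_norm_le_inv {c : Space → ℂ} (hc : Measurable c) {C : ℝ}
    (hb : ∀ x, ‖c x‖ ≤ C * ‖x‖⁻¹) {g : Space → Spinor} (hg : Continuous g)
    (hs : HasCompactSupport g) :
    MemLp (fun x ↦ c x • g x) 2 (volume : Measure Space) := by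
  have hm : AEStronglyMeasurable (fun x ↦ c x • g x) (volume : Measure Space) :=
    hc.aestronglyMeasurable.smul hg.aestronglyMeasurable
  rw [memLp_two_iff_integrable_sq_norm hm]
  have h1 : LocallyIntegrable (fun x ↦ ‖c x‖ ^ 2) (volume : Measure Space) := by
    refine locallyIntegrable_of_norm_le_rpow (C := C ^ 2) (α := 2) (by simp)
      (by simp; norm_num) (Filter.Eventually.of_forall fun x ↦ ?_)
      (hc.norm.pow_const 2).aestronglyMeasurable
    have h : ‖x‖ ^ (-2 : ℝ) = (‖x‖⁻¹) ^ 2 := by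
      rw [Real.rpow_neg (norm_nonneg _)]; simp
    rw [h, norm_pow, norm_norm, ← mul_pow]
    gcongr
    exact hb x
  have h2 := h1.integrable_smul_right_of_hasCompactSupport
    (g := fun x ↦ ‖g x‖ ^ 2) (by fun_prop)
    (hs.comp_left (g := fun v ↦ ‖v‖ ^ 2) (by simp))
  refine h2.congr (Filter.Eventually.of_forall fun x ↦ ?_)
  simp [norm_smul, mul_pow]

theorem memLp_potential (ν μ lam : ℝ) (φ : 𝓓(Ω, Spinor)) :
    MemLp (fun x ↦ (potential ν μ lam x).toEuclideanLin (φ x)) 2 (volume : Measure Space) := by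
  have key (A : Matrix (Fin 4) (Fin 4) ℂ) {c : Space → ℂ} (hc : Measurable c) {C : ℝ}
      (hb : ∀ x, ‖c x‖ ≤ C * ‖x‖⁻¹) :
      MemLp (fun x ↦ c x • A.toEuclideanLin (φ x)) 2 (volume : Measure Space) :=
    memLp_smul_of_norm_le_inv hc hb
      ((LinearMap.continuous_of_finiteDimensional A.toEuclideanLin).comp φ.continuous)
      (φ.hasCompactSupport.comp_left (map_zero A.toEuclideanLin))
  have h0 := key ((ν : ℂ) • 1 + (μ : ℂ) • beta) (c := fun x ↦ ((‖x‖⁻¹ : ℝ) : ℂ)) (C := 1)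
    (by fun_prop) (by simp)
  have hj (j : Fin 3) := key ((lam : ℂ) • ((-Complex.I) • (alpha j * beta)))
    (c := fun x ↦ ((‖x‖⁻¹ * (‖x‖⁻¹ * x j) : ℝ) : ℂ)) (C := 1) (by fun_prop) (fun x ↦ by
      rw [Complex.norm_real, norm_mul, norm_mul, norm_inv, norm_norm, mul_comm 1 ‖x‖⁻¹]
      gcongr
      rcases eq_or_ne x 0 with rfl | hx
      · simp
      · rw [inv_mul_le_iff₀ (norm_pos_iff.2 hx), mul_one]
        exact PiLp.norm_apply_le x j)
  have hsum := h0.add (memLp_finsetSum Finset.univ fun j _ ↦ hj j)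
  refine hsum.ae_eq (.of_forall fun x ↦ ?_)
  simp only [potential, alphaDot, Pi.add_apply, Finset.sum_mul, Finset.smul_sum, smul_add,
    map_add, map_sum, map_smul, LinearMap.add_apply, LinearMap.sum_apply, LinearMap.smul_apply,
    smul_mul_assoc]
  refine congrArg _ (Finset.sum_congr rfl fun j _ ↦ ?_)
  simp only [smul_smul, PiLp.smul_apply, smul_eq_mul, Complex.ofReal_mul]
  congr 1
  ring

theorem memLp_diracFun (m ν μ lam : ℝ) (φ : 𝓓(Ω, Spinor)) :
    MemLp (diracFun m ν μ lam φ) 2 (volume : Measure Space) := by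
  have h1 (j : Fin 3) : MemLp (fun x ↦ (alpha j).toEuclideanLin (partialDeriv j φ x)) 2
      (volume : Measure Space) := by
    have hc : Continuous (partialDeriv j φ) :=
      (φ.contDiff.continuous_fderiv (by simp)).clm_apply continuous_const
    have hs : HasCompactSupport (partialDeriv j φ) :=
      (φ.hasCompactSupport.fderiv (𝕜 := ℝ)).comp_left
        (g := fun L : Space →L[ℝ] Spinor ↦ L (EuclideanSpace.single j 1)) rfl
    exact Continuous.memLp_of_hasCompactSupport
      ((LinearMap.continuous_of_finiteDimensional (alpha j).toEuclideanLin).comp hc)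
      (hs.comp_left (map_zero (alpha j).toEuclideanLin))
  have h2 : MemLp (fun x ↦ beta.toEuclideanLin (φ x)) 2 (volume : Measure Space) :=
    Continuous.memLp_of_hasCompactSupport
      ((LinearMap.continuous_of_finiteDimensional beta.toEuclideanLin).comp φ.continuous)
      (φ.hasCompactSupport.comp_left (map_zero beta.toEuclideanLin))
  exact (((memLp_finsetSum Finset.univ fun j _ ↦ h1 j).const_smul (-Complex.I)).add
    (h2.const_smul (m : ℂ))).add (memLp_potential ν μ lam φ)

theorem diracFun_add (m ν μ lam : ℝ) (φ ψ : 𝓓(Ω, Spinor)) :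
    diracFun m ν μ lam (φ + ψ : 𝓓(Ω, Spinor)) =
      diracFun m ν μ lam φ + diracFun m ν μ lam ψ := by
  funext x
  have h (j : Fin 3) : partialDeriv j (φ + ψ : 𝓓(Ω, Spinor)) x =
      partialDeriv j φ x + partialDeriv j ψ x := by
    have hφ := (φ.contDiff.differentiable (by simp)) x
    have hψ := (ψ.contDiff.differentiable (by simp)) x
    have e : ((φ + ψ : 𝓓(Ω, Spinor)) : Space → Spinor) = φ + ψ := rfl
    simp only [partialDeriv, e]
    rw [fderiv_add hφ hψ]; rfl
  have e : (φ + ψ : 𝓓(Ω, Spinor)) x = φ x + ψ x := rfl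
  simp only [diracFun, h, e, map_add, Finset.sum_add_distrib, smul_add, Pi.add_apply]
  abel

theorem diracFun_smul (m ν μ lam : ℝ) (c : ℂ) (φ : 𝓓(Ω, Spinor)) :
    diracFun m ν μ lam (c • φ : 𝓓(Ω, Spinor)) = c • diracFun m ν μ lam φ := by
  funext x
  have h (j : Fin 3) : partialDeriv j (c • φ : 𝓓(Ω, Spinor)) x = c • partialDeriv j φ x := by
    have hφ := (φ.contDiff.differentiable (by simp)) x
    have e : ((c • φ : 𝓓(Ω, Spinor)) : Space → Spinor) = c • (φ : Space → Spinor) := rfl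
    simp only [partialDeriv, e]
    rw [fderiv_const_smul hφ]; rfl
  have e : (c • φ : 𝓓(Ω, Spinor)) x = c • φ x := rfl
  simp only [diracFun, h, e, map_smul, ← Finset.smul_sum, smul_add, Pi.smul_apply,
    smul_comm c]

/-- The inclusion of `C_c^∞(Ω)⁴` into `L²(ℝ³)⁴`. -/
def testToL2 (Ω : TopologicalSpace.Opens Space) : 𝓓(Ω, Spinor) →ₗ[ℂ] L2 where
  toFun φ := (memLp_testFunction φ).toLp φ
  map_add' _ _ := rfl
  map_smul' _ _ := rfl

/-- The map `φ ↦ Hφ` from `C_c^∞(Ω)⁴` to `L²(ℝ³)⁴`, where `Hφ` is computed classically. -/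
def diracTest (m ν μ lam : ℝ) (Ω : TopologicalSpace.Opens Space) : 𝓓(Ω, Spinor) →ₗ[ℂ] L2 where
  toFun φ := (memLp_diracFun m ν μ lam φ).toLp (diracFun m ν μ lam φ)
  map_add' φ ψ := by
    rw [← MemLp.toLp_add]
    exact MemLp.toLp_congr _ _ (.of_eq (diracFun_add m ν μ lam φ ψ))
  map_smul' c φ := by
    rw [RingHom.id_apply, ← MemLp.toLp_const_smul]
    exact MemLp.toLp_congr _ _ (.of_eq (diracFun_smul m ν μ lam c φ))

theorem testToL2_injective (Ω : TopologicalSpace.Opens Space) :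
    Function.Injective (testToL2 Ω) := by
  intro φ ψ h
  have h' : (φ : Space → Spinor) =ᵐ[volume] ψ :=
    (MemLp.toLp_eq_toLp_iff (memLp_testFunction φ) (memLp_testFunction ψ)).1 h
  exact DFunLike.coe_injective ((φ.continuous.ae_eq_iff_eq volume ψ.continuous).1 h')

/-- The operator `H` with domain `C_c^∞(Ω)⁴`, as an unbounded operator in `L²(ℝ³)⁴`.
For `Ω = ℝ³` this is the minimal operator, for `Ω = ℝ³ ∖ {0}` it is its restriction to
the test functions supported away from the origin. -/
def diracMin (m ν μ lam : ℝ) (Ω : TopologicalSpace.Opens Space) : L2 →ₗ.[ℂ] L2 where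
  domain := LinearMap.range (testToL2 Ω)
  toFun := diracTest m ν μ lam Ω ∘ₗ
    (LinearEquiv.ofInjective (testToL2 Ω) (testToL2_injective Ω)).symm

theorem mem_diracMin_domain (m ν μ lam : ℝ) (φ : 𝓓(Ω, Spinor)) :
    testToL2 Ω φ ∈ (diracMin m ν μ lam Ω).domain := ⟨φ, rfl⟩

theorem diracMin_apply (m ν μ lam : ℝ) (φ : 𝓓(Ω, Spinor)) :
    diracMin m ν μ lam Ω ⟨testToL2 Ω φ, mem_diracMin_domain m ν μ lam φ⟩ =
      diracTest m ν μ lam Ω φ := by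
  change diracTest m ν μ lam Ω
    ((LinearEquiv.ofInjective (testToL2 Ω) (testToL2_injective Ω)).symm
      (LinearEquiv.ofInjective (testToL2 Ω) (testToL2_injective Ω) φ)) = _
  rw [LinearEquiv.symm_apply_apply]

/-- The punctured space `ℝ³ ∖ {0}`, as an open set. -/
def punctured : TopologicalSpace.Opens Space := ⟨{0}ᶜ, isOpen_compl_singleton⟩

/-- `Hψ = η` in the distributional sense: `∫ ⟨Hφ, ψ⟩ = ∫ ⟨φ, η⟩` for all `φ ∈ C_c^∞(ℝ³)⁴`. -/
def IsDistribDirac (m ν μ lam : ℝ) (ψ η : L2) : Prop :=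
  ∀ φ : 𝓓((⊤ : TopologicalSpace.Opens Space), Spinor),
    ∫ x, inner ℂ (diracFun m ν μ lam φ x) (ψ x) = ∫ x, inner ℂ (φ x) (η x)

theorem isDistribDirac_iff {m ν μ lam : ℝ} {ψ η : L2} :
    IsDistribDirac m ν μ lam ψ η ↔ ∀ φ : 𝓓((⊤ : TopologicalSpace.Opens Space), Spinor),
      inner ℂ (diracTest m ν μ lam ⊤ φ) ψ = inner ℂ (testToL2 ⊤ φ) η := by
  refine forall_congr' fun φ ↦ ?_
  rw [L2.inner_def, L2.inner_def]
  have h1 : ∫ x, inner ℂ (diracTest m ν μ lam ⊤ φ x) (ψ x) =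
      ∫ x, inner ℂ (diracFun m ν μ lam φ x) (ψ x) :=
    integral_congr_ae ((memLp_diracFun m ν μ lam φ).coeFn_toLp.mono fun x hx ↦ by
      exact congrArg (fun v ↦ inner ℂ v (ψ x)) hx)
  have h2 : ∫ x, inner ℂ (testToL2 ⊤ φ x) (η x) = ∫ x, inner ℂ (φ x) (η x) :=
    integral_congr_ae ((memLp_testFunction φ).coeFn_toLp.mono fun x hx ↦ by
      exact congrArg (fun v ↦ inner ℂ v (η x)) hx)
  rw [h1, h2]

theorem IsDistribDirac.add {m ν μ lam : ℝ} {ψ η ψ' η' : L2} (h : IsDistribDirac m ν μ lam ψ η)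
    (h' : IsDistribDirac m ν μ lam ψ' η') : IsDistribDirac m ν μ lam (ψ + ψ') (η + η') := by
  rw [isDistribDirac_iff] at *
  intro φ
  rw [inner_add_right, inner_add_right, h, h']

theorem IsDistribDirac.smul {m ν μ lam : ℝ} {ψ η : L2} (c : ℂ)
    (h : IsDistribDirac m ν μ lam ψ η) : IsDistribDirac m ν μ lam (c • ψ) (c • η) := by
  rw [isDistribDirac_iff] at *
  intro φ
  rw [inner_smul_right, inner_smul_right, h]

theorem eq_zero_of_inner_testToL2 {η : L2} (h : ∀ φ, inner ℂ (testToL2 ⊤ φ) η = 0) : η = 0 := by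
  have hloc : LocallyIntegrable η (volume : Measure Space) :=
    (Lp.memLp η).locallyIntegrable (by norm_num)
  have hi (i : Fin 4) : ∀ᵐ x, η x i = 0 := by
    refine ae_eq_zero_of_integral_contDiff_smul_eq_zero
      (hloc.mono ?_ (.of_forall fun x ↦ PiLp.norm_apply_le (η x) i)) fun g hg hgs ↦ ?_
    · exact (EuclideanSpace.proj i).continuous.comp_aestronglyMeasurable
        (Lp.aestronglyMeasurable η)
    · let φ : 𝓓((⊤ : TopologicalSpace.Opens Space), Spinor) :=
        ⟨fun x ↦ g x • EuclideanSpace.single i 1, by fun_prop, hgs.smul_right, by simp⟩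
      have := h φ
      rw [L2.inner_def] at this
      rw [← this]
      refine integral_congr_ae ((memLp_testFunction φ).coeFn_toLp.mono fun x hx ↦ ?_)
      have e : inner ℂ (testToL2 ⊤ φ x) (η x) = inner ℂ (φ x) (η x) :=
        congrArg (fun v ↦ inner ℂ v (η x)) hx
      have e' : φ x = ((g x : ℝ) : ℂ) • EuclideanSpace.single i (1 : ℂ) := by
        ext k; simp [φ]
      change _ = inner ℂ (testToL2 ⊤ φ x) (η x)
      rw [e, e', inner_smul_left, EuclideanSpace.inner_single_left]
      simp
  rw [Lp.eq_zero_iff_ae_eq_zero]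
  filter_upwards [ae_all_iff.2 hi] with x hx
  ext i
  exact hx i

theorem IsDistribDirac.unique {m ν μ lam : ℝ} {ψ η η' : L2} (h : IsDistribDirac m ν μ lam ψ η)
    (h' : IsDistribDirac m ν μ lam ψ η') : η = η' := by
  rw [isDistribDirac_iff] at *
  rw [← sub_eq_zero]
  refine eq_zero_of_inner_testToL2 fun φ ↦ ?_
  rw [inner_sub_right, ← h, ← h', sub_self]

/-- The maximal operator: its domain is the set of `ψ ∈ L²(ℝ³)⁴` with `Hψ ∈ L²(ℝ³)⁴` in the
distributional sense, and it maps such a `ψ` to `Hψ`. -/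
def diracMax (m ν μ lam : ℝ) : L2 →ₗ.[ℂ] L2 where
  domain :=
    { carrier := {ψ | ∃ η, IsDistribDirac m ν μ lam ψ η}
      add_mem' := fun ⟨_, h⟩ ⟨_, h'⟩ ↦ ⟨_, h.add h'⟩
      zero_mem' := ⟨0, isDistribDirac_iff.2 fun φ ↦ by simp⟩
      smul_mem' := fun c _ ⟨_, h⟩ ↦ ⟨_, h.smul c⟩ }
  toFun :=
    { toFun := fun ψ ↦ ψ.2.choose
      map_add' := fun ψ ψ' ↦
        (ψ + ψ').2.choose_spec.unique (ψ.2.choose_spec.add ψ'.2.choose_spec)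
      map_smul' := fun c ψ ↦
        (c • ψ).2.choose_spec.unique (ψ.2.choose_spec.smul c) }

theorem diracMax_spec (m ν μ lam : ℝ) (ψ : (diracMax m ν μ lam).domain) :
    IsDistribDirac m ν μ lam ψ (diracMax m ν μ lam ψ) := ψ.2.choose_spec

/-- The Sobolev space `H¹(ℝ³)⁴`, as a subspace of `L²(ℝ³)⁴`. -/
def sobolevH1 : Submodule ℂ L2 where
  carrier := {ψ | TemperedDistribution.MemSobolev 1 2 (ψ : 𝓢'(Space, Spinor))}
  add_mem' {ψ ψ'} h h' := by
    have := h.add h'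
    rwa [← Lp.toTemperedDistributionCLM_apply, ← Lp.toTemperedDistributionCLM_apply,
      ← map_add] at this
  zero_mem' := by
    have := TemperedDistribution.memSobolev_fun_zero Space Spinor 1 2
    rwa [← map_zero (Lp.toTemperedDistributionCLM Spinor (volume : Measure Space) 2)] at this
  smul_mem' c ψ h := by
    have := h.smul c
    rwa [← Lp.toTemperedDistributionCLM_apply, ← map_smul] at this

/-- A densely defined symmetric operator is essentially self-adjoint if its closure is
self-adjoint. -/
def IsEssentiallySelfAdjoint (T : L2 →ₗ.[ℂ] L2) : Prop :=
  Dense (T.domain : Set L2) ∧ T.IsFormalAdjoint T ∧ T.IsClosable ∧ IsSelfAdjoint T.closure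

end DiracOp

end

/-!
The proof is a continuity method in the coupling constant `μ`, starting from the free operator.

The heart is a Hardy-type inequality that is uniform in `μ`: for spinor fields `φ` supported away
from the origin, `¼ ‖φ / |x|‖² ≤ ‖(-i α · ∇ + μ β / |x|) φ‖²` (`integral_norm_inv_smul_sq_le`).
Since the matrices `i αⱼ β` are Hermitian and `‖α · ∇φ‖ = ‖∇φ‖`, integration by parts turns the
right-hand side into `∑ⱼ ‖∂ⱼφ + xⱼ φ / (2 |x|²) + μ i αⱼ β φ / (2 |x|)‖²` plus
`(1 + μ²) / 4 · ‖φ / |x|‖²`. Adding the mass and `± i` costs only a constant, because the operator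
is symmetric. Hence the term `β / |x|` is bounded relative to `H ± i`, with a bound that does not
depend on `μ`. So density of the range of `H ± i` propagates from `μ = 0` to every `μ` in
finitely many small steps (`eq_zero_of_orthogonal_range_of_path`), and all the closures have the
same domain (`diracMin_closure_domain_le`).

For the free operator the origin is removable: cutoffs with `|∇η| ≤ C / |x|` and the
integrability of `|x|⁻²` in three dimensions show that an `L²` solution of the equation tested on
`ℝ³ ∖ {0}` is a solution for tempered distributions (`isTemperedDirac_of_punctured`). Squaring the
operator gives `-Δ + m²`, so that `L²` data force `ψ ∈ H¹` (`IsTemperedDirac.memSobolev`) and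
`± i` is not an eigenvalue (`IsTemperedDirac.eq_zero`). This gives essential self-adjointness at
`μ = 0`, with `H¹` as the domain of the adjoint, hence of the closure.

Finally, the operator on all test functions is a symmetric extension of an essentially self-adjoint
one, so that it has the same closure, and the maximal operator is its adjoint.
-/

/-! ### Unbounded symmetric operators -/

section Abstract

open Filter Topology
open scoped InnerProductSpace

variable {V E : Type*} [AddCommGroup V] [Module ℂ V] [NormedAddCommGroup E]
  [InnerProductSpace ℂ E]

/-- If `⟪a, x⟫` is real, as for `a = A x` with `A` symmetric, then `a` and `c • x` with `c`
imaginary are orthogonal in the real sense. -/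
theorem norm_add_smul_sq_of_symmetric {a x : E} (h : ⟪a, x⟫_ℂ = ⟪x, a⟫_ℂ) {c : ℂ} (hc : c.re = 0) :
    ‖a + c • x‖ ^ 2 = ‖a‖ ^ 2 + ‖c‖ ^ 2 * ‖x‖ ^ 2 := by
  have him : (⟪a, x⟫_ℂ).im = 0 := by
    have h1 := congrArg Complex.im (inner_conj_symm (𝕜 := ℂ) x a)
    rw [← h] at h1
    simp only [Complex.conj_im] at h1
    linarith
  have hre : RCLike.re ⟪a, c • x⟫_ℂ = 0 := by
    rw [inner_smul_right]
    simp [hc, him]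
  rw [norm_add_sq (𝕜 := ℂ), hre, norm_smul]
  ring

namespace LinearPMap

variable {T S : E →ₗ.[ℂ] E}

theorem mem_closure_graph_iff_exists_seq (hT : T.IsClosable) {p : E × E} :
    p ∈ T.closure.graph ↔ ∃ x : ℕ → T.domain, Tendsto (fun n ↦ (x n : E)) atTop (𝓝 p.1) ∧
      Tendsto (fun n ↦ T (x n)) atTop (𝓝 p.2) := by
  rw [← hT.graph_closure_eq_closure_graph, ← SetLike.mem_coe, Submodule.topologicalClosure_coe,
    mem_closure_iff_seq_limit]
  constructor
  · rintro ⟨q, hq, hlim⟩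
    choose x hx using fun n ↦ (T.mem_graph_iff).1 (hq n)
    refine ⟨x, ?_, ?_⟩
    · simp only [(hx _).1]
      exact (continuous_fst.tendsto p).comp hlim
    · simp only [(hx _).2]
      exact (continuous_snd.tendsto p).comp hlim
  · rintro ⟨x, h1, h2⟩
    exact ⟨fun n ↦ (x n, T (x n)), fun n ↦ T.mem_graph (x n), h1.prodMk_nhds h2⟩

theorem closure_le_of_isClosed (hS : S.IsClosed) (h : T ≤ S) : T.closure ≤ S := by
  refine le_of_le_graph ?_
  rw [← (hS.isClosable.leIsClosable h).graph_closure_eq_closure_graph]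
  exact Submodule.topologicalClosure_minimal _ (le_graph_of_le h) hS

end LinearPMap

variable [CompleteSpace E]

/-- If the range of `P` has trivial orthogonal complement, so has the range of a relatively small
perturbation `Q` of `P`. -/
theorem eq_zero_of_orthogonal_range_of_norm_sub_le {P Q : V →ₗ[ℂ] E} {C : ℝ} (hC : C < 1)
    (hPQ : ∀ φ, ‖Q φ - P φ‖ ≤ C * ‖P φ‖) (hP : ∀ u, (∀ φ, ⟪P φ, u⟫_ℂ = 0) → u = 0)
    {u : E} (hu : ∀ φ, ⟪Q φ, u⟫_ℂ = 0) : u = 0 := by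
  have hdense : Dense (LinearMap.range P : Set E) := by
    rw [Submodule.dense_iff_topologicalClosure_eq_top, Submodule.topologicalClosure_eq_top_iff,
      Submodule.eq_bot_iff]
    intro x hx
    exact hP x fun φ ↦ (Submodule.mem_orthogonal _ _).1 hx _ (LinearMap.mem_range_self P φ)
  have hclosed : IsClosed {v : E | ‖⟪v, u⟫_ℂ‖ ≤ C * ‖v‖ * ‖u‖} :=
    isClosed_le (by fun_prop) (by fun_prop)
  have hsub : (LinearMap.range P : Set E) ⊆ {v : E | ‖⟪v, u⟫_ℂ‖ ≤ C * ‖v‖ * ‖u‖} := by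
    rintro _ ⟨φ, rfl⟩
    have h : ⟪P φ, u⟫_ℂ = -⟪Q φ - P φ, u⟫_ℂ := by rw [inner_sub_left, hu, zero_sub, neg_neg]
    rw [Set.mem_ofPred_eq, h, norm_neg]
    exact (norm_inner_le_norm _ _).trans (by gcongr; exact hPQ φ)
  have h : ‖⟪u, u⟫_ℂ‖ ≤ C * ‖u‖ * ‖u‖ := hclosed.closure_subset_iff.2 hsub (hdense u)
  rw [inner_self_eq_norm_sq_to_K] at h
  norm_num at h
  by_contra hne
  have := norm_pos_iff.2 hne
  nlinarith [mul_pos this this]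

/-- Continuity method: the orthogonal complement of the range of `P t` stays trivial along a path
on which `P` is uniformly relatively Lipschitz. -/
theorem eq_zero_of_orthogonal_range_of_path {P : ℝ → V →ₗ[ℂ] E} {K : ℝ} (hK : 0 ≤ K)
    (hP : ∀ s t φ, ‖P t φ - P s φ‖ ≤ K * |t - s| * ‖P s φ‖)
    (h0 : ∀ u, (∀ φ, ⟪P 0 φ, u⟫_ℂ = 0) → u = 0) (t : ℝ) :
    ∀ u, (∀ φ, ⟪P t φ, u⟫_ℂ = 0) → u = 0 := by
  obtain ⟨n, hn⟩ := exists_nat_gt (K * |t|)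
  have hn0 : (0 : ℝ) < n := (by positivity : 0 ≤ K * |t|).trans_lt hn
  have key (k : ℕ) : ∀ u, (∀ φ, ⟪P (k * (t / n)) φ, u⟫_ℂ = 0) → u = 0 := by
    induction k with
    | zero => simpa using h0
    | succ k ih =>
      intro u hu
      refine eq_zero_of_orthogonal_range_of_norm_sub_le (C := K * |t / n|) ?_ (fun φ ↦ ?_) ih hu
      · rw [abs_div, Nat.abs_cast, ← mul_div_assoc, div_lt_one hn0]
        exact hn
      · have := hP (k * (t / n)) ((k + 1 : ℕ) * (t / n)) φ
        rwa [← sub_mul, Nat.cast_succ, add_sub_cancel_left, one_mul, ← Nat.cast_succ] at this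
  have := key n
  rwa [mul_div_cancel₀ _ hn0.ne'] at this

namespace LinearPMap

variable {T S : E →ₗ.[ℂ] E}

theorem isClosable_of_symmetric (hd : Dense (T.domain : Set E)) (hs : T.IsFormalAdjoint T) :
    T.IsClosable :=
  isClosable_iff_exists_closed_extension.2 ⟨_, adjoint_isClosed hd, hs.le_adjoint hd⟩

theorem adjoint_anti (hT : Dense (T.domain : Set E)) (h : T ≤ S) : S.adjoint ≤ T.adjoint := by
  have hS : Dense (S.domain : Set E) := hT.mono h.1
  refine IsFormalAdjoint.le_adjoint hT fun x y ↦ ?_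
  have := adjoint_isFormalAdjoint hS y ⟨x, h.1 x.2⟩
  rw [← h.2 (x := x) (y := ⟨x, h.1 x.2⟩) rfl] at this
  rw [← inner_conj_symm, ← this, inner_conj_symm]

theorem adjoint_closure (hd : Dense (T.domain : Set E)) (hc : T.IsClosable) :
    T.closure.adjoint = T.adjoint := by
  refine le_antisymm (adjoint_anti hd T.le_closure) ?_
  refine IsFormalAdjoint.le_adjoint (hd.mono T.le_closure.1) fun x y ↦ ?_
  obtain ⟨z, h1, h2⟩ := (mem_closure_graph_iff_exists_seq hc).1 (T.closure.mem_graph x)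
  refine tendsto_nhds_unique (h2.inner (tendsto_const_nhds (x := (y : E)))) ?_
  convert h1.inner (tendsto_const_nhds (x := T.adjoint y)) using 2 with n
  exact ((adjoint_isFormalAdjoint hd).symm) (z n) y

theorem adjoint_eq_closure_of_isSelfAdjoint_closure (hd : Dense (T.domain : Set E))
    (hc : T.IsClosable) (h : IsSelfAdjoint T.closure) : T.adjoint = T.closure := by
  rw [← adjoint_closure hd hc]
  exact h

/-- Basic criterion for self-adjointness of the closure: the ranges of `T + i` and `T - i` have
trivial orthogonal complement. -/
theorem isSelfAdjoint_closure_of_orthogonal_range (hd : Dense (T.domain : Set E))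
    (hs : T.IsFormalAdjoint T)
    (hr : ∀ c : ℂ, c = Complex.I ∨ c = -Complex.I →
      ∀ u, (∀ x : T.domain, ⟪T x + c • (x : E), u⟫_ℂ = 0) → u = 0) :
    IsSelfAdjoint T.closure := by
  have hc := isClosable_of_symmetric hd hs
  have hle : T.closure ≤ T.adjoint :=
    closure_le_of_isClosed (adjoint_isClosed hd) (hs.le_adjoint hd)
  rw [isSelfAdjoint_def, adjoint_closure hd hc]
  refine le_antisymm (le_of_le_graph ?_) hle
  rintro ⟨ψ, η⟩ hψ
  -- Approximate `η + i ψ` by `(T + i) xₙ`; then `xₙ` and `T xₙ` are Cauchy sequences.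
  let P : T.domain →ₗ[ℂ] E := T.toFun + Complex.I • T.domain.subtype
  have hP (x : T.domain) : P x = T x + Complex.I • (x : E) := rfl
  have hdense : Dense (LinearMap.range P : Set E) := by
    rw [Submodule.dense_iff_topologicalClosure_eq_top, Submodule.topologicalClosure_eq_top_iff,
      Submodule.eq_bot_iff]
    intro u hu
    exact hr _ (.inl rfl) u fun x ↦
      (Submodule.mem_orthogonal _ _).1 hu _ (LinearMap.mem_range_self P x)
  have hnorm (x : T.domain) : ‖P x‖ ^ 2 = ‖T x‖ ^ 2 + ‖(x : E)‖ ^ 2 := by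
    have := norm_add_smul_sq_of_symmetric (hs x x) (c := Complex.I) (by simp)
    simpa [hP] using this
  have hx_le (x : T.domain) : ‖(x : E)‖ ≤ ‖P x‖ :=
    le_of_sq_le_sq (by rw [hnorm]; nlinarith [sq_nonneg ‖T x‖]) (norm_nonneg _)
  have hT_le (x : T.domain) : ‖T x‖ ≤ ‖P x‖ :=
    le_of_sq_le_sq (by rw [hnorm]; nlinarith [sq_nonneg ‖(x : E)‖]) (norm_nonneg _)
  obtain ⟨q, hq, hlim⟩ := mem_closure_iff_seq_limit.1 (hdense (η + Complex.I • ψ))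
  choose x hx using hq
  have hcau : CauchySeq fun n ↦ P (x n) := by
    simp only [hx]
    exact hlim.cauchySeq
  have hcauchy (f : T.domain →ₗ[ℂ] E) (hf : ∀ x, ‖f x‖ ≤ ‖P x‖) :
      CauchySeq fun n ↦ f (x n) := by
    rw [Metric.cauchySeq_iff'] at hcau ⊢
    intro ε hε
    obtain ⟨N, hN⟩ := hcau ε hε
    refine ⟨N, fun n hn ↦ lt_of_le_of_lt ?_ (hN n hn)⟩
    rw [dist_eq_norm, dist_eq_norm, ← _root_.map_sub f, ← _root_.map_sub P]
    exact hf (x n - x N)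
  obtain ⟨a, ha⟩ := cauchySeq_tendsto_of_complete (hcauchy T.domain.subtype hx_le)
  obtain ⟨b, hb⟩ := cauchySeq_tendsto_of_complete (hcauchy T.toFun hT_le)
  have hab : (a, b) ∈ T.closure.graph := (mem_closure_graph_iff_exists_seq hc).2 ⟨x, ha, hb⟩
  have hsum : b + Complex.I • a = η + Complex.I • ψ := by
    refine tendsto_nhds_unique (hb.add (ha.const_smul Complex.I)) ?_
    refine hlim.congr fun n ↦ ?_
    rw [← hx]
    rfl
  -- `ψ - a` lies in the kernel of the adjoint of `T - i`.
  have hmem : (ψ - a, η - b) ∈ T.adjoint.graph :=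
    T.adjoint.graph.sub_mem hψ (le_graph_of_le hle hab)
  have hηb : η - b = -(Complex.I • (ψ - a)) := by
    rw [smul_sub, neg_sub, sub_eq_sub_iff_add_eq_add, add_comm _ b, hsum]
  have hψa : ψ - a = 0 := by
    refine hr _ (.inr rfl) _ fun y ↦ ?_
    rw [adjoint_graph_eq_graph_adjoint hd, Submodule.mem_adjoint_iff] at hmem
    have := hmem y (T y) (T.mem_graph y)
    rw [sub_eq_zero, hηb] at this
    simp only at this
    rw [inner_add_left, this, inner_neg_right, inner_smul_right, inner_smul_left]
    simp
  have hηb' : η - b = 0 := by rw [hηb, hψa, smul_zero, neg_zero]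
  rwa [sub_eq_zero.1 hψa, sub_eq_zero.1 hηb']

/-- A relative bound of `S` by `T` compares the domains of the closures. -/
theorem closure_domain_le_of_norm_le (hT : T.IsClosable) (hS : S.IsClosable)
    (hdom : T.domain = S.domain) {C : ℝ}
    (h : ∀ x (hx : x ∈ T.domain) (hx' : x ∈ S.domain),
      ‖S ⟨x, hx'⟩‖ ≤ C * (‖T ⟨x, hx⟩‖ + ‖x‖)) :
    T.closure.domain ≤ S.closure.domain := by
  intro ψ hψ
  obtain ⟨x, h1, h2⟩ := (mem_closure_graph_iff_exists_seq hT).1 (T.closure.mem_graph ⟨ψ, hψ⟩)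
  let y (n : ℕ) : S.domain := ⟨x n, hdom ▸ (x n).2⟩
  have hbound (i j : ℕ) :
      ‖S (y i) - S (y j)‖ ≤ C * (‖T (x i) - T (x j)‖ + ‖(x i : E) - x j‖) := by
    rw [← map_sub, ← map_sub]
    exact h _ (x i - x j).2 (y i - y j).2
  have hcS : CauchySeq fun n ↦ S (y n) := by
    rw [cauchySeq_iff_tendsto_dist_atTop_0]
    have e1 := cauchySeq_iff_tendsto_dist_atTop_0.1 h1.cauchySeq
    have e2 := cauchySeq_iff_tendsto_dist_atTop_0.1 h2.cauchySeq
    have e3 := (e2.add e1).const_mul C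
    rw [add_zero, mul_zero] at e3
    refine squeeze_zero (fun _ ↦ dist_nonneg) (fun p ↦ ?_) e3
    simpa only [dist_eq_norm] using hbound p.1 p.2
  obtain ⟨b, hb⟩ := cauchySeq_tendsto_of_complete hcS
  exact mem_domain_of_mem_graph
    ((mem_closure_graph_iff_exists_seq hS).2 ⟨y, h1, hb⟩ : (ψ, b) ∈ S.closure.graph)

/-- A symmetric extension of an essentially self-adjoint operator has the same closure. -/
theorem closure_eq_of_le_of_symmetric (hd : Dense (T.domain : Set E)) (hc : T.IsClosable)
    (h : IsSelfAdjoint T.closure) (hle : T ≤ S) (hs : S.IsFormalAdjoint S) :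
    S.closure = T.closure := by
  have hdS : Dense (S.domain : Set E) := hd.mono hle.1
  have hcS := isClosable_of_symmetric hdS hs
  refine le_antisymm ?_ (hcS.closure_mono hle)
  rw [← adjoint_eq_closure_of_isSelfAdjoint_closure hd hc h]
  exact closure_le_of_isClosed (adjoint_isClosed hd)
    ((hs.le_adjoint hdS).trans (adjoint_anti hd hle))

end LinearPMap

end Abstract

noncomputable section

namespace DiracOp

open scoped InnerProductSpace
open Matrix (toEuclideanLin)

/-! ### Dirac matrices -/

theorem alpha_isHermitian (j : Fin 3) : (alpha j).IsHermitian := by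
  fin_cases j <;> ext a b <;> fin_cases a <;> fin_cases b <;>
    simp [alpha, pauli, Matrix.conjTranspose_apply]

theorem beta_isHermitian : beta.IsHermitian := by
  ext a b
  fin_cases a <;> fin_cases b <;> simp [beta, Matrix.conjTranspose_apply]

theorem alpha_mul_self (j : Fin 3) : alpha j * alpha j = 1 := by
  fin_cases j <;> ext a b <;> fin_cases a <;> fin_cases b <;> simp [alpha, pauli]

theorem alpha_mul_alpha_of_ne {j k : Fin 3} (h : j ≠ k) :
    alpha j * alpha k = -(alpha k * alpha j) := by
  fin_cases j <;> fin_cases k <;> first | exact absurd rfl h | skip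
  all_goals ext a b; fin_cases a <;> fin_cases b <;> simp [alpha, pauli]

theorem alpha_mul_beta (j : Fin 3) : alpha j * beta = -(beta * alpha j) := by
  fin_cases j <;> ext a b <;> fin_cases a <;> fin_cases b <;>
    simp [alpha, beta, pauli, Matrix.mul_apply, Fin.sum_univ_four]

theorem beta_mul_beta : beta * beta = 1 := by
  ext a b
  fin_cases a <;> fin_cases b <;> simp [beta, Matrix.mul_apply, Fin.sum_univ_four]

/-- The action of `αⱼ` on spinors. -/
def alphaL (j : Fin 3) : Spinor →L[ℂ] Spinor := (toEuclideanLin (alpha j)).toContinuousLinearMap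

/-- The action of `β` on spinors. -/
def betaL : Spinor →L[ℂ] Spinor := (toEuclideanLin beta).toContinuousLinearMap

theorem inner_alphaL (j : Fin 3) (v w : Spinor) : ⟪alphaL j v, w⟫_ℂ = ⟪v, alphaL j w⟫_ℂ := by
  have := Matrix.isSymmetric_toEuclideanLin_iff.2 (alpha_isHermitian j) v w
  exact this

theorem inner_betaL (v w : Spinor) : ⟪betaL v, w⟫_ℂ = ⟪v, betaL w⟫_ℂ := by
  have := Matrix.isSymmetric_toEuclideanLin_iff.2 beta_isHermitian v w
  exact this

theorem toEuclideanLin_mul_apply (A B : Matrix (Fin 4) (Fin 4) ℂ) (v : Spinor) :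
    toEuclideanLin (A * B) v = toEuclideanLin A (toEuclideanLin B v) := by
  simp [Matrix.toLpLin_apply, Matrix.mulVec_mulVec]

theorem alphaL_alphaL_self (j : Fin 3) (v : Spinor) : alphaL j (alphaL j v) = v := by
  have e := toEuclideanLin_mul_apply (alpha j) (alpha j) v
  rw [alpha_mul_self] at e
  simpa [alphaL] using e.symm

theorem alphaL_alphaL_of_ne {j k : Fin 3} (h : j ≠ k) (v : Spinor) :
    alphaL j (alphaL k v) = -alphaL k (alphaL j v) := by
  have e := toEuclideanLin_mul_apply (alpha j) (alpha k) v
  rw [alpha_mul_alpha_of_ne h, map_neg, LinearMap.neg_apply, toEuclideanLin_mul_apply] at e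
  exact e.symm

theorem alphaL_betaL (j : Fin 3) (v : Spinor) : alphaL j (betaL v) = -betaL (alphaL j v) := by
  have e := toEuclideanLin_mul_apply (alpha j) beta v
  rw [alpha_mul_beta, map_neg, LinearMap.neg_apply, toEuclideanLin_mul_apply] at e
  exact e.symm

theorem betaL_betaL (v : Spinor) : betaL (betaL v) = v := by
  have e := toEuclideanLin_mul_apply beta beta v
  rw [beta_mul_beta] at e
  simpa [betaL] using e.symm

theorem norm_alphaL (j : Fin 3) (v : Spinor) : ‖alphaL j v‖ = ‖v‖ := by
  rw [norm_eq_sqrt_re_inner (𝕜 := ℂ), inner_alphaL, alphaL_alphaL_self,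
    ← norm_eq_sqrt_re_inner (𝕜 := ℂ)]

theorem norm_betaL (v : Spinor) : ‖betaL v‖ = ‖v‖ := by
  rw [norm_eq_sqrt_re_inner (𝕜 := ℂ), inner_betaL, betaL_betaL,
    ← norm_eq_sqrt_re_inner (𝕜 := ℂ)]

/-- The Hermitian matrices `i αⱼ β`; they anticommute and square to `1`. -/
def mixL (j : Fin 3) : Spinor →L[ℂ] Spinor := Complex.I • (alphaL j ∘L betaL)

theorem mixL_apply (j : Fin 3) (v : Spinor) : mixL j v = Complex.I • alphaL j (betaL v) := rfl

theorem inner_mixL (j : Fin 3) (v w : Spinor) : ⟪mixL j v, w⟫_ℂ = ⟪v, mixL j w⟫_ℂ := by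
  rw [mixL_apply, mixL_apply, inner_smul_left, inner_smul_right, inner_alphaL, inner_betaL,
    alphaL_betaL, inner_neg_right]
  simp

theorem norm_mixL (j : Fin 3) (v : Spinor) : ‖mixL j v‖ = ‖v‖ := by
  rw [mixL_apply, norm_smul, norm_alphaL, norm_betaL, Complex.norm_I, one_mul]

/-- The Dirac expression with the Lorentz-scalar potential `μ / |x|`. -/
theorem diracFun_scalar (m μ : ℝ) (φ : Space → Spinor) (x : Space) :
    diracFun m 0 μ 0 φ x = (-Complex.I) • (∑ j, alphaL j (partialDeriv j φ x))
      + (m : ℂ) • betaL (φ x) + (μ : ℂ) • betaL (((‖x‖⁻¹ : ℝ) : ℂ) • φ x) := by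
  simp only [diracFun, potential, alphaL, betaL, Complex.ofReal_zero, zero_smul, zero_add,
    add_zero, map_smul, LinearMap.smul_apply, LinearMap.coe_toContinuousLinearMap']
  rw [smul_comm (μ : ℂ)]

/-! ### Integration by parts -/

theorem contDiff_partialDeriv {n : WithTop ℕ∞} {f : Space → Spinor} (hf : ContDiff ℝ (n + 1) f)
    (j : Fin 3) : ContDiff ℝ n (partialDeriv j f) :=
  (hf.fderiv_right le_rfl).clm_apply contDiff_const

theorem hasCompactSupport_partialDeriv {f : Space → Spinor} (hf : HasCompactSupport f)
    (j : Fin 3) : HasCompactSupport (partialDeriv j f) :=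
  (hf.fderiv (𝕜 := ℝ)).comp_left
    (g := fun L : Space →L[ℝ] Spinor ↦ L (EuclideanSpace.single j 1)) rfl

theorem partialDeriv_comm {f : Space → Spinor} (hf : ContDiff ℝ 2 f) (j k : Fin 3) :
    partialDeriv j (partialDeriv k f) = partialDeriv k (partialDeriv j f) := by
  have h (i : Fin 3) (x : Space) (v : Space) :
      fderiv ℝ (partialDeriv i f) x v = fderiv ℝ (fderiv ℝ f) x v (EuclideanSpace.single i 1) := by
    have hd : DifferentiableAt ℝ (fderiv ℝ f) x :=
      (hf.fderiv_right (m := 1) le_rfl).differentiable one_ne_zero x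
    have := (hd.hasFDerivAt.clm_apply
      (hasFDerivAt_const (EuclideanSpace.single i (1 : ℝ)) x)).fderiv
    change fderiv ℝ (fun y ↦ fderiv ℝ f y (EuclideanSpace.single i 1)) x v = _
    rw [this]
    simp
  funext x
  rw [partialDeriv, h, partialDeriv, h]
  exact (hf.contDiffAt.isSymmSndFDerivAt (by simp)) _ _

theorem partialDeriv_clm_comp {f : Space → Spinor} (A : Spinor →L[ℂ] Spinor) {x : Space}
    (hf : DifferentiableAt ℝ f x) (j : Fin 3) :
    partialDeriv j (fun y ↦ A (f y)) x = A (partialDeriv j f x) := by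
  have := ((A.restrictScalars ℝ).hasFDerivAt.comp x hf.hasFDerivAt).fderiv
  change fderiv ℝ ((A.restrictScalars ℝ) ∘ f) x _ = _
  rw [this]
  rfl

theorem partialDeriv_smul {f : Space → Spinor} {w : Space → ℝ} {x : Space}
    (hw : DifferentiableAt ℝ w x) (hf : DifferentiableAt ℝ f x) (j : Fin 3) :
    partialDeriv j (fun y ↦ (w y : ℂ) • f y) x =
      (w x : ℂ) • partialDeriv j f x +
        (fderiv ℝ w x (EuclideanSpace.single j 1) : ℂ) • f x := by
  have := (hw.hasFDerivAt.smul hf.hasFDerivAt).fderiv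
  change fderiv ℝ (fun y ↦ (w y : ℂ) • f y) x _ = _
  simp only [Complex.coe_smul] at *
  rw [show (fun y ↦ w y • f y) = w • f from rfl, this]
  simp [partialDeriv]

theorem integrable_inner_of_hasCompactSupport {f g : Space → Spinor} (hf : Continuous f)
    (hg : Continuous g) (hs : HasCompactSupport f) : Integrable fun x ↦ ⟪f x, g x⟫_ℂ :=
  (hf.inner hg).integrable_of_hasCompactSupport (hs.mono fun x hx ↦ by
    contrapose! hx
    simp [Function.notMem_support.1 hx])

theorem integral_inner_partialDeriv {f g : Space → Spinor} (hf : ContDiff ℝ 1 f)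
    (hg : ContDiff ℝ 1 g) (hs : HasCompactSupport f) (j : Fin 3) :
    ∫ x, ⟪partialDeriv j f x, g x⟫_ℂ = -∫ x, ⟪f x, partialDeriv j g x⟫_ℂ := by
  have hf' : Continuous (partialDeriv j f) := (contDiff_partialDeriv (n := 0) hf j).continuous
  have hg' : Continuous (partialDeriv j g) := (contDiff_partialDeriv (n := 0) hg j).continuous
  have hfd := hf.differentiable one_ne_zero
  have hgd := hg.differentiable one_ne_zero
  have hs' := hasCompactSupport_partialDeriv hs j
  have h := integral_bilinear_fderiv_right_eq_neg_left_of_integrable (μ := volume)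
    (f := f) (g := g) (v := EuclideanSpace.single j 1)
    (B := (isBoundedBilinearMap_inner (𝕜 := ℂ) (E := Spinor)).toContinuousLinearMap)
    (integrable_inner_of_hasCompactSupport hf' hg.continuous hs')
    (integrable_inner_of_hasCompactSupport hf.continuous hg' hs)
    (integrable_inner_of_hasCompactSupport hf.continuous hg.continuous hs)
    (fun x _ ↦ hfd x) (fun x _ ↦ hgd x)
  exact (neg_eq_iff_eq_neg.2 h).symm

end DiracOp

end

noncomputable section

namespace DiracOp

open scoped InnerProductSpace

/-! ### The Hardy-type inequality -/

theorem contDiff_smul_of_tsupport {n : WithTop ℕ∞} {f : Space → Spinor} {w : Space → ℝ}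
    (hw : ∀ x, x ≠ 0 → ContDiffAt ℝ n w x) (hf : ContDiff ℝ n f) (h0 : (0 : Space) ∉ tsupport f) :
    ContDiff ℝ n fun x ↦ (w x : ℂ) • f x := by
  simp only [Complex.coe_smul]
  refine contDiff_iff_contDiffAt.2 fun x ↦ ?_
  by_cases hx : x ∈ tsupport f
  · exact (hw x (ne_of_mem_of_not_mem hx h0)).smul hf.contDiffAt
  · refine (contDiffAt_const (c := (0 : Spinor))).congr_of_eventuallyEq ?_
    filter_upwards [notMem_tsupport_iff_eventuallyEq.1 hx] with y hy
    simp [hy]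

theorem zero_notMem_tsupport (φ : 𝓓(punctured, Spinor)) : (0 : Space) ∉ tsupport φ :=
  fun h ↦ φ.tsupport_subset h rfl

theorem contDiffAt_norm_inv {n : WithTop ℕ∞} {x : Space} (hx : x ≠ 0) :
    ContDiffAt ℝ n (fun y : Space ↦ ‖y‖⁻¹) x :=
  (contDiffAt_norm ℝ hx).inv (norm_ne_zero_iff.2 hx)

theorem contDiffAt_coord {n : WithTop ℕ∞} {x : Space} (j : Fin 3) :
    ContDiffAt ℝ n (fun y : Space ↦ y j) x :=
  (EuclideanSpace.proj (𝕜 := ℝ) j).contDiff.contDiffAt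

theorem fderiv_norm_single {x : Space} (hx : x ≠ 0) (j : Fin 3) :
    fderiv ℝ (fun y : Space ↦ ‖y‖) x (EuclideanSpace.single j 1) = ‖x‖⁻¹ * x j := by
  have hd := (contDiffAt_norm ℝ (n := 1) hx).differentiableAt one_ne_zero
  have h1 := (hd.hasFDerivAt.pow 2).fderiv
  have h2 := fderiv_norm_sq_apply x
  have h3 : fderiv ℝ (fun y : Space ↦ ‖y‖ ^ 2) x = fderiv ℝ (fun y : Space ↦ ‖y‖) x ∘L
      ((2 * ‖x‖) • ContinuousLinearMap.id ℝ Space) := by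
    rw [h1]
    ext v
    simp
  have h4 := congrArg (fun L : Space →L[ℝ] ℝ ↦ L (EuclideanSpace.single j 1)) (h2.symm.trans h3)
  simp [EuclideanSpace.inner_single_right] at h4
  rw [eq_inv_mul_iff_mul_eq₀ (norm_ne_zero_iff.2 hx)]
  linarith

/-- The derivative of the weight `1 / |x|`. -/
theorem fderiv_norm_inv {x : Space} (hx : x ≠ 0) (j : Fin 3) :
    fderiv ℝ (fun y : Space ↦ ‖y‖⁻¹) x (EuclideanSpace.single j 1) = -(x j * ‖x‖⁻¹ ^ 3) := by
  have hd := (contDiffAt_norm ℝ (n := 1) hx).differentiableAt one_ne_zero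
  have := ((hasDerivAt_inv (norm_ne_zero_iff.2 hx)).comp_hasFDerivAt x hd.hasFDerivAt).fderiv
  change fderiv ℝ (Inv.inv ∘ fun y : Space ↦ ‖y‖) x _ = _
  rw [this]
  simp [fderiv_norm_single hx]
  ring

/-- The diagonal derivatives of the weights `xⱼ / |x|²`. -/
theorem fderiv_coord_mul_norm_inv_sq {x : Space} (hx : x ≠ 0) (j : Fin 3) :
    fderiv ℝ (fun y : Space ↦ y j * ‖y‖⁻¹ ^ 2) x (EuclideanSpace.single j 1) =
      ‖x‖⁻¹ ^ 2 - 2 * x j ^ 2 * ‖x‖⁻¹ ^ 4 := by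
  have h1 : HasFDerivAt (fun y : Space ↦ y j) (EuclideanSpace.proj (𝕜 := ℝ) j : Space →L[ℝ] ℝ) x :=
    (EuclideanSpace.proj (𝕜 := ℝ) j : Space →L[ℝ] ℝ).hasFDerivAt
  have h2 := ((contDiffAt_norm_inv (n := 1) hx).differentiableAt one_ne_zero).hasFDerivAt
  have := (h1.mul (h2.pow 2)).fderiv
  change fderiv ℝ ((fun y : Space ↦ y j) * fun y : Space ↦ ‖y‖⁻¹ ^ 2) x _ = _
  rw [this]
  simp [fderiv_norm_inv hx]
  ring

variable (φ : 𝓓(punctured, Spinor))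

theorem integrable_re_inner {f g : Space → Spinor} (hf : Continuous f) (hg : Continuous g)
    (hs : HasCompactSupport f) : Integrable fun x ↦ RCLike.re ⟪f x, g x⟫_ℂ :=
  (integrable_inner_of_hasCompactSupport hf hg hs).re

theorem continuous_weight_smul {w : Space → ℝ} (hw : ∀ x, x ≠ 0 → ContDiffAt ℝ 1 w x)
    (A : Spinor →L[ℂ] Spinor) : Continuous fun x ↦ (w x : ℂ) • A (φ x) := by
  have h := (contDiff_smul_of_tsupport (n := 0) (fun x hx ↦ (hw x hx).of_le zero_le)
    (φ.contDiff.of_le zero_le) (zero_notMem_tsupport φ)).continuous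
  simpa only [Function.comp_def, map_smul] using A.continuous.comp h

/-- Integration by parts against a real weight and a Hermitian matrix. -/
theorem integral_re_inner_partialDeriv_smul {w : Space → ℝ}
    (hw : ∀ x, x ≠ 0 → ContDiffAt ℝ 1 w x) {A : Spinor →L[ℂ] Spinor}
    (hA : ∀ v v', ⟪A v, v'⟫_ℂ = ⟪v, A v'⟫_ℂ) (j : Fin 3) :
    ∫ x, RCLike.re ⟪partialDeriv j φ x, (w x : ℂ) • A (φ x)⟫_ℂ =
      -(1 / 2) * ∫ x, fderiv ℝ w x (EuclideanSpace.single j 1) * RCLike.re ⟪φ x, A (φ x)⟫_ℂ := by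
  have hφ : ContDiff ℝ 1 φ := φ.contDiff.of_le (by simp)
  have h0 := zero_notMem_tsupport φ
  have hφ0 : φ (0 : Space) = 0 := image_eq_zero_of_notMem_tsupport h0
  let g : Space → Spinor := fun x ↦ (w x : ℂ) • A (φ x)
  have hg : ContDiff ℝ 1 g := by
    have := (A.restrictScalars ℝ).contDiff.comp (contDiff_smul_of_tsupport hw hφ h0)
    simpa only [Function.comp_def, ContinuousLinearMap.coe_restrictScalars', map_smul] using this
  have hdφ := (contDiff_partialDeriv (n := 0) hφ j).continuous
  have hdg := (contDiff_partialDeriv (n := 0) hg j).continuous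
  have hsd := hasCompactSupport_partialDeriv φ.hasCompactSupport j
  have hpt (x : Space) : RCLike.re ⟪φ x, partialDeriv j g x⟫_ℂ =
      RCLike.re ⟪partialDeriv j φ x, g x⟫_ℂ +
        fderiv ℝ w x (EuclideanSpace.single j 1) * RCLike.re ⟪φ x, A (φ x)⟫_ℂ := by
    rcases eq_or_ne x 0 with rfl | hx
    · simp [g, hφ0]
    have hd : DifferentiableAt ℝ φ x := hφ.differentiable one_ne_zero x
    have hAd : DifferentiableAt ℝ (fun y ↦ A (φ y)) x :=
      (A.restrictScalars ℝ).differentiableAt.comp x hd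
    rw [partialDeriv_smul ((hw x hx).differentiableAt one_ne_zero) hAd,
      partialDeriv_clm_comp A hd, inner_add_right, map_add, inner_smul_right, inner_smul_right,
      inner_smul_right, ← hA]
    simp only [RCLike.re_to_complex, Complex.re_ofReal_mul]
    rw [← inner_conj_symm (A (φ x)), Complex.conj_re]
  have h1 := integral_inner_partialDeriv hφ hg φ.hasCompactSupport j
  have hi1 := integrable_re_inner hdφ hg.continuous hsd
  have hi2 := integrable_re_inner hφ.continuous hdg φ.hasCompactSupport
  have h2 : ∫ x, RCLike.re ⟪partialDeriv j φ x, g x⟫_ℂ =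
      -∫ x, RCLike.re ⟪φ x, partialDeriv j g x⟫_ℂ := by
    rw [integral_re, integral_re, h1, map_neg]
    · exact integrable_inner_of_hasCompactSupport hφ.continuous hdg φ.hasCompactSupport
    · exact integrable_inner_of_hasCompactSupport hdφ hg.continuous hsd
  have h3 : ∫ x, fderiv ℝ w x (EuclideanSpace.single j 1) * RCLike.re ⟪φ x, A (φ x)⟫_ℂ =
      (∫ x, RCLike.re ⟪φ x, partialDeriv j g x⟫_ℂ) -
        ∫ x, RCLike.re ⟪partialDeriv j φ x, g x⟫_ℂ := by
    rw [← integral_sub hi2 hi1]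
    refine integral_congr_ae (.of_forall fun x ↦ ?_)
    simp only [hpt]
    ring
  rw [h3]
  linarith

theorem integral_norm_sq_eq_re_inner {f : Space → Spinor} (hf : Continuous f)
    (hs : HasCompactSupport f) :
    ∫ x, ‖f x‖ ^ 2 = RCLike.re (∫ x, ⟪f x, f x⟫_ℂ) := by
  rw [← integral_re (integrable_inner_of_hasCompactSupport hf hf hs)]
  simp only [inner_self_eq_norm_sq]

/-- `‖α · ∇φ‖ = ‖∇φ‖`: the Dirac operator is a square root of the Laplacian. -/
theorem integral_norm_sum_alphaL_sq {f : Space → Spinor} (hf : ContDiff ℝ 2 f)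
    (hs : HasCompactSupport f) :
    ∫ x, ‖∑ j, alphaL j (partialDeriv j f x)‖ ^ 2 = ∑ j, ∫ x, ‖partialDeriv j f x‖ ^ 2 := by
  have hd (j : Fin 3) : ContDiff ℝ 1 (partialDeriv j f) := contDiff_partialDeriv hf j
  have hsd (j : Fin 3) := hasCompactSupport_partialDeriv hs j
  have hc (j k : Fin 3) : Continuous fun x ↦ alphaL j (alphaL k (partialDeriv k f x)) := by
    have := (hd k).continuous
    fun_prop
  let c (j k : Fin 3) : ℂ := ∫ x, ⟪partialDeriv j f x, alphaL j (alphaL k (partialDeriv k f x))⟫_ℂ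
  have hcjk (j k : Fin 3) :
      c j k = -∫ x, ⟪f x, alphaL j (alphaL k (partialDeriv j (partialDeriv k f) x))⟫_ℂ := by
    have hg : ContDiff ℝ 1 fun x ↦ (alphaL j ∘L alphaL k) (partialDeriv k f x) :=
      ((alphaL j ∘L alphaL k).restrictScalars ℝ).contDiff.comp (hd k)
    have := integral_inner_partialDeriv (hf.of_le one_le_two) hg hs j
    simp only [partialDeriv_clm_comp _ ((hd k).differentiable one_ne_zero _)] at this
    exact this
  -- The mixed terms cancel in pairs because the `αⱼ` anticommute.
  have hanti {j k : Fin 3} (h : j ≠ k) : c j k + c k j = 0 := by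
    rw [hcjk, hcjk, partialDeriv_comm hf k j]
    simp only [alphaL_alphaL_of_ne h, inner_neg_right, integral_neg]
    ring
  have hsum : ∫ x, ⟪∑ j, alphaL j (partialDeriv j f x), ∑ k, alphaL k (partialDeriv k f x)⟫_ℂ =
      ∑ k, ∑ j, c j k := by
    simp only [sum_inner, inner_sum, inner_alphaL]
    rw [integral_finsetSum]
    · refine Finset.sum_congr rfl fun k _ ↦ ?_
      rw [integral_finsetSum]
      exact fun j _ ↦ integrable_inner_of_hasCompactSupport (hd j).continuous (hc j k) (hsd j)
    · exact fun k _ ↦ integrable_finsetSum _ fun j _ ↦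
        integrable_inner_of_hasCompactSupport (hd j).continuous (hc j k) (hsd j)
  have hdiag (j : Fin 3) : RCLike.re (c j j) = ∫ x, ‖partialDeriv j f x‖ ^ 2 := by
    rw [integral_norm_sq_eq_re_inner (hd j).continuous (hsd j)]
    simp only [c, alphaL_alphaL_self]
  rw [integral_norm_sq_eq_re_inner, hsum]
  · have h01 := hanti (j := 0) (k := 1) (by decide)
    have h02 := hanti (j := 0) (k := 2) (by decide)
    have h12 := hanti (j := 1) (k := 2) (by decide)
    have : ∑ k, ∑ j, c j k = c 0 0 + c 1 1 + c 2 2 := by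
      simp only [Fin.sum_univ_three]
      linear_combination h01 + h02 + h12
    rw [this, Fin.sum_univ_three, map_add, map_add, hdiag, hdiag, hdiag]
  · exact continuous_finsetSum _ fun j _ ↦ (alphaL j).continuous.comp (hd j).continuous
  · have hs3 (j : Fin 3) : HasCompactSupport fun x ↦ alphaL j (partialDeriv j f x) :=
      (hsd j).comp_left (map_zero (alphaL j))
    simp only [Fin.sum_univ_three]
    exact ((hs3 0).add (hs3 1)).add (hs3 2)

/-- The pointwise completion of the square behind the Hardy-type inequality. -/
theorem norm_sq_dirac_eq (μ ρ : ℝ) (x : Fin 3 → ℝ) (hx : ρ ^ 2 * ∑ j, x j ^ 2 = 1)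
    (d : Fin 3 → Spinor) (p : Spinor) :
    ‖(-Complex.I) • (∑ j, alphaL j (d j)) + (μ : ℂ) • betaL ((ρ : ℂ) • p)‖ ^ 2 =
      ∑ j, ‖d j + ((x j * ρ ^ 2 / 2 : ℝ) : ℂ) • p + ((μ * ρ / 2 : ℝ) : ℂ) • mixL j p‖ ^ 2
      + ‖∑ j, alphaL j (d j)‖ ^ 2 - ∑ j, ‖d j‖ ^ 2
      - ∑ j, RCLike.re ⟪d j, ((x j * ρ ^ 2 : ℝ) : ℂ) • p⟫_ℂ
      + μ * ∑ j, RCLike.re ⟪d j, (ρ : ℂ) • mixL j p⟫_ℂ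
      - μ / 2 * ∑ j, RCLike.re ⟪p, ((x j * ρ ^ 3 : ℝ) : ℂ) • mixL j p⟫_ℂ
      + (μ ^ 2 - 1) / 4 * (ρ ^ 2 * ‖p‖ ^ 2) := by
  have h1 : ‖(-Complex.I) • (∑ j, alphaL j (d j)) + (μ : ℂ) • betaL ((ρ : ℂ) • p)‖ ^ 2 =
      ‖∑ j, alphaL j (d j)‖ ^ 2 + 2 * (μ * ∑ j, RCLike.re ⟪d j, (ρ : ℂ) • mixL j p⟫_ℂ)
        + μ ^ 2 * (ρ ^ 2 * ‖p‖ ^ 2) := by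
    rw [norm_add_sq (𝕜 := ℂ)]
    congr 1
    · congr 1
      · rw [norm_smul]; simp
      · congr 1
        simp only [mixL_apply, inner_smul_left, inner_smul_right, map_smul, sum_inner,
          inner_alphaL, map_sum, Finset.mul_sum]
        refine Finset.sum_congr rfl fun j _ ↦ ?_
        simp
    · rw [norm_smul, norm_betaL, norm_smul]
      simp [mul_pow]
  have h2 (j : Fin 3) :
      ‖d j + ((x j * ρ ^ 2 / 2 : ℝ) : ℂ) • p + ((μ * ρ / 2 : ℝ) : ℂ) • mixL j p‖ ^ 2 =
      ‖d j‖ ^ 2 + RCLike.re ⟪d j, ((x j * ρ ^ 2 : ℝ) : ℂ) • p⟫_ℂ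
      + μ * RCLike.re ⟪d j, (ρ : ℂ) • mixL j p⟫_ℂ
      + μ / 2 * RCLike.re ⟪p, ((x j * ρ ^ 3 : ℝ) : ℂ) • mixL j p⟫_ℂ
      + (x j ^ 2 * ρ ^ 4 / 4 + μ ^ 2 * ρ ^ 2 / 4) * ‖p‖ ^ 2 := by
    rw [norm_add_sq (𝕜 := ℂ), norm_add_sq (𝕜 := ℂ), norm_smul, norm_smul, norm_mixL,
      inner_add_left, map_add]
    simp only [inner_smul_left, inner_smul_right, Complex.conj_ofReal, RCLike.re_to_complex,
      Complex.re_ofReal_mul, Complex.norm_real, mul_pow, Real.norm_eq_abs, sq_abs]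
    ring
  rw [h1]
  simp only [h2, Fin.sum_univ_three] at hx ⊢
  linear_combination (-(ρ ^ 2 * ‖p‖ ^ 2) / 4) * hx

theorem ae_ne_zero : ∀ᵐ x : Space, x ≠ 0 := compl_mem_ae_iff.2 (measure_singleton 0)

theorem norm_inv_sq_mul_sum_sq {x : Space} (hx : x ≠ 0) : ‖x‖⁻¹ ^ 2 * ∑ j, x j ^ 2 = 1 := by
  rw [← EuclideanSpace.real_norm_sq_eq, ← mul_pow, inv_mul_cancel₀ (norm_ne_zero_iff.2 hx),
    one_pow]

theorem integrable_weight_mul_norm_sq {w : Space → ℝ}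
    (hw : ∀ x, x ≠ 0 → ContDiffAt ℝ 1 w x) : Integrable fun x ↦ w x * ‖φ x‖ ^ 2 := by
  refine (integrable_re_inner φ.continuous (continuous_weight_smul φ hw (.id ℂ Spinor))
    φ.hasCompactSupport).congr (.of_forall fun x ↦ ?_)
  simp [inner_self_eq_norm_sq_to_K, ← Complex.ofReal_pow]

theorem contDiffAt_coord_mul_norm_inv_pow {x : Space} (hx : x ≠ 0) (j : Fin 3) (k : ℕ) :
    ContDiffAt ℝ 1 (fun y : Space ↦ y j * ‖y‖⁻¹ ^ k) x :=
  (contDiffAt_coord j).mul ((contDiffAt_norm_inv hx).pow k)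

/-- The divergence of `x / |x|²` is `1 / |x|²`. -/
theorem sum_integral_re_inner_partialDeriv_coord :
    ∑ j, ∫ x, RCLike.re ⟪partialDeriv j φ x, ((x j * ‖x‖⁻¹ ^ 2 : ℝ) : ℂ) • φ x⟫_ℂ =
      -(1 / 2) * ∫ x, ‖x‖⁻¹ ^ 2 * ‖φ x‖ ^ 2 := by
  have h1 (j : Fin 3) : ∫ x, RCLike.re ⟪partialDeriv j φ x,
      ((x j * ‖x‖⁻¹ ^ 2 : ℝ) : ℂ) • φ x⟫_ℂ =
      -(1 / 2) * ∫ x, (‖x‖⁻¹ ^ 2 - 2 * x j ^ 2 * ‖x‖⁻¹ ^ 4) * ‖φ x‖ ^ 2 := by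
    have := integral_re_inner_partialDeriv_smul φ
      (fun x hx ↦ contDiffAt_coord_mul_norm_inv_pow hx j 2)
      (A := .id ℂ Spinor) (fun _ _ ↦ rfl) j
    refine this.trans (congrArg _ (integral_congr_ae ?_))
    filter_upwards [ae_ne_zero] with x hx
    rw [fderiv_coord_mul_norm_inv_sq hx, ContinuousLinearMap.id_apply, inner_self_eq_norm_sq]
  simp only [h1]
  rw [← Finset.mul_sum, ← integral_finsetSum]
  · refine congrArg _ (integral_congr_ae ?_)
    filter_upwards [ae_ne_zero] with x hx
    have := norm_inv_sq_mul_sum_sq hx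
    simp only [Fin.sum_univ_three] at this ⊢
    linear_combination (-2 * ‖x‖⁻¹ ^ 2 * ‖φ x‖ ^ 2) * this
  · exact fun j _ ↦ integrable_weight_mul_norm_sq φ fun x hx ↦ ((contDiffAt_norm_inv hx).pow 2).sub
      ((contDiffAt_const.mul ((contDiffAt_coord j).pow 2)).mul ((contDiffAt_norm_inv hx).pow 4))

theorem integral_re_inner_partialDeriv_mixL (j : Fin 3) :
    ∫ x, RCLike.re ⟪partialDeriv j φ x, ((‖x‖⁻¹ : ℝ) : ℂ) • mixL j (φ x)⟫_ℂ =
      1 / 2 * ∫ x, RCLike.re ⟪φ x, ((x j * ‖x‖⁻¹ ^ 3 : ℝ) : ℂ) • mixL j (φ x)⟫_ℂ := by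
  rw [integral_re_inner_partialDeriv_smul φ (fun x hx ↦ contDiffAt_norm_inv hx) (inner_mixL j) j,
    neg_mul, ← mul_neg, ← integral_neg]
  refine congrArg _ (integral_congr_ae ?_)
  filter_upwards [ae_ne_zero] with x hx
  rw [fderiv_norm_inv hx, inner_smul_right, RCLike.re_to_complex, RCLike.re_to_complex,
    Complex.re_ofReal_mul]
  ring

theorem integral_linear_combination {S D P Q K J : Space → ℝ} (hS : Integrable S)
    (hD : Integrable D) (hP : Integrable P) (hQ : Integrable Q) (hK : Integrable K)
    (hJ : Integrable J) (a b c : ℝ) :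
    Integrable (fun x ↦ S x - D x - P x + a * Q x - b * K x + c * J x) ∧
    ∫ x, (S x - D x - P x + a * Q x - b * K x + c * J x) =
      (∫ x, S x) - (∫ x, D x) - (∫ x, P x) + a * (∫ x, Q x) - b * (∫ x, K x) + c * ∫ x, J x := by
  have h1 := hS.sub hD
  have h2 := h1.sub hP
  have h3 := h2.add (hQ.const_mul a)
  have h4 := h3.sub (hK.const_mul b)
  refine ⟨h4.add (hJ.const_mul c), ?_⟩
  exact (integral_add h4 (hJ.const_mul c)).trans (congrArg₂ (· + ·)
    ((integral_sub h3 (hK.const_mul b)).trans (congrArg₂ (· - ·)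
      ((integral_add h2 (hQ.const_mul a)).trans (congrArg₂ (· + ·)
        ((integral_sub h1 hP).trans (congrArg (· - _) (integral_sub hS hD)))
        (integral_const_mul _ _)))
      (integral_const_mul _ _)))
    (integral_const_mul _ _))

/-- Hardy-type inequality for the massless operator, uniform in the coupling constant: completing
the square with `∂ⱼφ + xⱼ φ / (2 |x|²) + μ i αⱼ β φ / (2 |x|)` leaves the remainder
`(1 + μ²) / 4 · ‖φ / |x|‖²`. -/
theorem integral_norm_inv_smul_sq_le (μ : ℝ) :
    1 / 4 * ∫ x, ‖x‖⁻¹ ^ 2 * ‖φ x‖ ^ 2 ≤ ∫ x, ‖diracFun 0 0 μ 0 φ x‖ ^ 2 := by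
  have hφ : ContDiff ℝ 2 φ := mod_cast contDiff_infty.1 φ.contDiff 2
  have hφc : Continuous φ := hφ.continuous
  have hφs : HasCompactSupport φ := φ.hasCompactSupport
  have hd (j : Fin 3) : Continuous (partialDeriv j φ) :=
    (contDiff_partialDeriv (n := 1) hφ j).continuous
  have hds (j : Fin 3) := hasCompactSupport_partialDeriv hφs j
  have hiJ : Integrable fun x ↦ ‖x‖⁻¹ ^ 2 * ‖φ x‖ ^ 2 :=
    integrable_weight_mul_norm_sq φ fun x hx ↦ (contDiffAt_norm_inv hx).pow 2
  have hiK (j : Fin 3) : Integrable fun x ↦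
      RCLike.re ⟪φ x, ((x j * ‖x‖⁻¹ ^ 3 : ℝ) : ℂ) • mixL j (φ x)⟫_ℂ :=
    integrable_re_inner hφc
      (continuous_weight_smul φ (fun x hx ↦ contDiffAt_coord_mul_norm_inv_pow hx j 3) _) hφs
  have hiP (j : Fin 3) : Integrable fun x ↦
      RCLike.re ⟪partialDeriv j φ x, ((x j * ‖x‖⁻¹ ^ 2 : ℝ) : ℂ) • φ x⟫_ℂ :=
    integrable_re_inner (hd j) (continuous_weight_smul φ
      (fun x hx ↦ contDiffAt_coord_mul_norm_inv_pow hx j 2) (.id ℂ Spinor)) (hds j)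
  have hiQ (j : Fin 3) : Integrable fun x ↦
      RCLike.re ⟪partialDeriv j φ x, ((‖x‖⁻¹ : ℝ) : ℂ) • mixL j (φ x)⟫_ℂ :=
    integrable_re_inner (hd j)
      (continuous_weight_smul φ (fun x hx ↦ contDiffAt_norm_inv hx) _) (hds j)
  have hsq {f : Space → Spinor} (hf : Continuous f) (hs : HasCompactSupport f) :
      Integrable fun x ↦ ‖f x‖ ^ 2 := by
    simpa only [inner_self_eq_norm_sq] using integrable_re_inner hf hf hs
  have hiS : Integrable fun x ↦ ‖∑ j, alphaL j (partialDeriv j φ x)‖ ^ 2 := by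
    have hs3 (j : Fin 3) : HasCompactSupport fun x ↦ alphaL j (partialDeriv j φ x) :=
      (hds j).comp_left (map_zero (alphaL j))
    refine hsq (continuous_finsetSum _ fun j _ ↦ (alphaL j).continuous.comp (hd j)) ?_
    simp only [Fin.sum_univ_three]
    exact ((hs3 0).add (hs3 1)).add (hs3 2)
  obtain ⟨hi, hval⟩ := integral_linear_combination hiS
    (integrable_finsetSum Finset.univ fun j _ ↦ hsq (hd j) (hds j))
    (integrable_finsetSum Finset.univ fun j _ ↦ hiP j)
    (integrable_finsetSum Finset.univ fun j _ ↦ hiQ j)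
    (integrable_finsetSum Finset.univ fun j _ ↦ hiK j) hiJ μ (μ / 2) ((μ ^ 2 - 1) / 4)
  rw [integral_norm_sum_alphaL_sq hφ hφs, integral_finsetSum _ fun j _ ↦ hsq (hd j) (hds j),
    integral_finsetSum _ fun j _ ↦ hiP j, integral_finsetSum _ fun j _ ↦ hiQ j,
    integral_finsetSum _ fun j _ ↦ hiK j, sum_integral_re_inner_partialDeriv_coord] at hval
  simp only [integral_re_inner_partialDeriv_mixL, ← Finset.mul_sum] at hval
  have hiH : Integrable fun x ↦ ‖diracFun 0 0 μ 0 φ x‖ ^ 2 :=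
    (memLp_diracFun 0 0 μ 0 φ).integrable_norm_pow two_ne_zero
  have hle := integral_mono_ae hi hiH (by
    filter_upwards [ae_ne_zero] with x hx
    have := norm_sq_dirac_eq μ ‖x‖⁻¹ x (norm_inv_sq_mul_sum_sq hx)
      (fun j ↦ partialDeriv j φ x) (φ x)
    rw [diracFun_scalar, Complex.ofReal_zero, zero_smul, add_zero, this]
    have hE : 0 ≤ ∑ j, ‖partialDeriv j φ x + ((x j * ‖x‖⁻¹ ^ 2 / 2 : ℝ) : ℂ) • φ x
      + ((μ * ‖x‖⁻¹ / 2 : ℝ) : ℂ) • mixL j (φ x)‖ ^ 2 :=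
      Finset.sum_nonneg fun _ _ ↦ sq_nonneg _
    linarith)
  have hJ : 0 ≤ ∫ x, ‖x‖⁻¹ ^ 2 * ‖φ x‖ ^ 2 := integral_nonneg fun x ↦ by positivity
  rw [hval] at hle
  nlinarith [mul_nonneg (sq_nonneg μ) hJ]

end DiracOp

end

noncomputable section

namespace DiracOp

open Filter Topology
open scoped InnerProductSpace LineDeriv Laplacian

/-! ### Removing the singularity by cutoffs -/

/-- Cutoffs `ηₙ` vanishing near the origin and near infinity, with `|∇ηₙ| ≤ C / |x|`. The bound is
scale invariant, which is what makes both cutoffs harmless in `L²(ℝ³)`. -/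
theorem exists_cutoff : ∃ (η : ℕ → Space → ℝ) (C : ℝ), 0 ≤ C ∧ (∀ n, ContDiff ℝ ∞ (η n)) ∧
    (∀ n, HasCompactSupport (η n)) ∧ (∀ n, (0 : Space) ∉ tsupport (η n)) ∧
    (∀ n x, |η n x| ≤ 1) ∧ (∀ n x, x ≠ 0 → ‖fderiv ℝ (η n) x‖ ≤ C * ‖x‖⁻¹) ∧
    ∀ x, x ≠ 0 → ∀ᶠ n in atTop, η n =ᶠ[𝓝 x] fun _ ↦ 1 := by
  let θ : ContDiffBump (0 : Space) := ⟨1, 2, one_pos, one_lt_two⟩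
  have hθ : ContDiff ℝ ∞ θ := θ.contDiff
  have hθ1 {y : Space} (hy : ‖y‖ ≤ 1) : θ y = 1 := θ.one_of_mem_closedBall (by simpa using hy)
  have hθ0 {y : Space} (hy : 2 ≤ ‖y‖) : θ y = 0 := θ.zero_of_le_dist (by simpa using hy)
  have habs (y : Space) : |θ y| ≤ 1 := by
    rw [abs_of_nonneg θ.nonneg]
    exact θ.le_one
  have habs' (y : Space) : |1 - θ y| ≤ 1 := by
    rw [abs_of_nonneg (by linarith [θ.le_one (x := y)])]
    linarith [θ.nonneg (x := y)]
  have hcd : Continuous (fderiv ℝ θ) := hθ.continuous_fderiv (by simp)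
  obtain ⟨C, hC⟩ := ((θ.hasCompactSupport.fderiv (𝕜 := ℝ)).smul_left
    (f := fun y : Space ↦ ‖y‖)).exists_bound_of_continuous (continuous_norm.smul hcd)
  have hC0 : 0 ≤ C := (norm_nonneg _).trans (hC 0)
  have hscale {c : ℝ} (hc : 0 < c) {x : Space} (hx : x ≠ 0) :
      ‖fderiv ℝ (fun y ↦ θ (c • y)) x‖ ≤ C * ‖x‖⁻¹ := by
    have h := hC (c • x)
    simp only [Pi.smul_apply', norm_smul, Real.norm_eq_abs, abs_mul, abs_norm, abs_of_pos hc] at h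
    rw [fderiv_comp_smul, norm_smul, Real.norm_eq_abs, abs_of_pos hc, ← div_eq_mul_inv,
      le_div_iff₀ (norm_pos_iff.2 hx)]
    linarith
  have hsm (c : ℝ) : ContDiff ℝ ∞ fun y : Space ↦ θ (c • y) := hθ.comp (contDiff_const_smul c)
  have hN (n : ℕ) : (0 : ℝ) < n + 1 := by positivity
  let η (n : ℕ) (x : Space) : ℝ := (1 - θ (((n : ℝ) + 1) • x)) * θ (((n : ℝ) + 1)⁻¹ • x)
  refine ⟨η, 2 * C, by positivity, fun n ↦ (contDiff_const.sub (hsm _)).mul (hsm _), fun n ↦ ?_,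
    fun n ↦ ?_, fun n x ↦ ?_, fun n x hx ↦ ?_, fun x hx ↦ ?_⟩
  · exact (θ.hasCompactSupport.comp_smul (inv_ne_zero (hN n).ne')).mul_left
  · rw [notMem_tsupport_iff_eventuallyEq]
    have hlim : Tendsto (fun x : Space ↦ ‖((n : ℝ) + 1) • x‖) (𝓝 0) (𝓝 0) := by
      have : Continuous fun x : Space ↦ ‖((n : ℝ) + 1) • x‖ := by fun_prop
      simpa using this.tendsto 0
    filter_upwards [hlim.eventually_le_const one_pos] with x hx
    simp [η, hθ1 hx]
  · rw [abs_mul]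
    exact mul_le_one₀ (habs' _) (abs_nonneg _) (habs _)
  · have hd (c : ℝ) : HasFDerivAt (fun y : Space ↦ θ (c • y)) _ x :=
      ((hsm c).differentiable (by simp) x).hasFDerivAt
    have h := (((hasFDerivAt_const (1 : ℝ) x).sub (hd ((n : ℝ) + 1))).mul
      (hd ((n : ℝ) + 1)⁻¹)).fderiv
    change ‖fderiv ℝ ((fun y ↦ 1 - θ (((n : ℝ) + 1) • y)) * fun y ↦ θ (((n : ℝ) + 1)⁻¹ • y)) x‖ ≤ _
    refine (congrArg norm h).le.trans ?_
    rw [zero_sub, two_mul, add_mul]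
    refine (norm_add_le _ _).trans (add_le_add ?_ ?_)
    · rw [norm_smul, ← one_mul (C * _)]
      exact mul_le_mul (habs' _) (hscale (inv_pos.2 (hN n)) hx) (norm_nonneg _) zero_le_one
    · rw [norm_smul, norm_neg, ← one_mul (C * _)]
      exact mul_le_mul (habs _) (hscale (hN n) hx) (norm_nonneg _) zero_le_one
  · have hxp := norm_pos_iff.2 hx
    obtain ⟨k, hk⟩ := exists_nat_gt (max (4 / ‖x‖) (2 * ‖x‖))
    filter_upwards [eventually_ge_atTop k] with n hn
    have hkn : (k : ℝ) ≤ n := by exact_mod_cast hn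
    have h1 : 4 / ‖x‖ < n + 1 := by linarith [(le_max_left _ _).trans_lt hk]
    have h2 : 2 * ‖x‖ < n + 1 := by linarith [(le_max_right _ _).trans_lt hk]
    rw [div_lt_iff₀ hxp] at h1
    have hlo : ∀ᶠ y : Space in 𝓝 x, ‖x‖ / 2 < ‖y‖ :=
      continuous_norm.continuousAt.eventually_const_lt (by linarith)
    have hhi : ∀ᶠ y : Space in 𝓝 x, ‖y‖ < 2 * ‖x‖ :=
      continuous_norm.continuousAt.eventually_lt_const (by linarith)
    filter_upwards [hlo, hhi] with y hy1 hy2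
    have e1 : θ (((n : ℝ) + 1) • y) = 0 := hθ0 (by
      rw [norm_smul, Real.norm_eq_abs, abs_of_pos (hN n)]
      nlinarith [hN n])
    have e2 : θ (((n : ℝ) + 1)⁻¹ • y) = 1 := hθ1 (by
      rw [norm_smul, norm_inv, Real.norm_eq_abs, abs_of_pos (hN n), inv_mul_le_iff₀ (hN n)]
      linarith)
    simp [η, e1, e2]

theorem inner_diracTest_eq_integral (m ν μ lam : ℝ) {Ω : TopologicalSpace.Opens Space}
    (φ : 𝓓(Ω, Spinor)) (ψ : L2) :
    ⟪diracTest m ν μ lam Ω φ, ψ⟫_ℂ = ∫ x, ⟪diracFun m ν μ lam φ x, ψ x⟫_ℂ := by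
  rw [L2.inner_def]
  exact integral_congr_ae ((memLp_diracFun m ν μ lam φ).coeFn_toLp.mono fun x hx ↦
    congrArg (fun v ↦ ⟪v, ψ x⟫_ℂ) hx)

theorem inner_testToL2_eq_integral {Ω : TopologicalSpace.Opens Space}
    (φ : 𝓓(Ω, Spinor)) (ψ : L2) :
    ⟪testToL2 Ω φ, ψ⟫_ℂ = ∫ x, ⟪φ x, ψ x⟫_ℂ := by
  rw [L2.inner_def]
  exact integral_congr_ae ((memLp_testFunction φ).coeFn_toLp.mono fun x hx ↦
    congrArg (fun v ↦ ⟪v, ψ x⟫_ℂ) hx)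

theorem diracFun_free (m : ℝ) (φ : Space → Spinor) (x : Space) :
    diracFun m 0 0 0 φ x = (-Complex.I) • (∑ j, alphaL j (partialDeriv j φ x))
      + (m : ℂ) • betaL (φ x) := by
  rw [diracFun_scalar, Complex.ofReal_zero, zero_smul, add_zero]

theorem norm_diracFun_free_le (m : ℝ) (φ : Space → Spinor) (x : Space) :
    ‖diracFun m 0 0 0 φ x‖ ≤ (∑ j, ‖partialDeriv j φ x‖) + |m| * ‖φ x‖ := by
  rw [diracFun_free]
  refine (norm_add_le _ _).trans (add_le_add ?_ ?_)
  · rw [norm_smul, norm_neg, Complex.norm_I, one_mul]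
    refine (norm_sum_le _ _).trans (Finset.sum_le_sum fun j _ ↦ ?_)
    rw [norm_alphaL]
  · rw [norm_smul, norm_betaL, Complex.norm_real, Real.norm_eq_abs]

/-- A weak solution of the free Dirac equation on `ℝ³ ∖ {0}` is a weak solution on `ℝ³`, and may be
tested against functions that need not have compact support. -/
theorem integral_inner_diracFun_of_punctured {m : ℝ} {ψ η : L2}
    (h : ∀ φ : 𝓓(punctured, Spinor),
      ⟪diracTest m 0 0 0 punctured φ, ψ⟫_ℂ = ⟪testToL2 punctured φ, η⟫_ℂ)
    {f : Space → Spinor} (hf : ContDiff ℝ ∞ f) (hf2 : MemLp f 2)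
    (hfd : ∀ j, MemLp (partialDeriv j f) 2) (hfr : MemLp (fun x ↦ ‖x‖⁻¹ * ‖f x‖) 2) :
    ∫ x, ⟪diracFun m 0 0 0 f x, ψ x⟫_ℂ = ∫ x, ⟪f x, η x⟫_ℂ := by
  obtain ⟨χ, C, hC0, hχ, hχs, hχ0, hχ1, hχd, hχlim⟩ := exists_cutoff
  let φ (n : ℕ) : 𝓓(punctured, Spinor) := ⟨fun x ↦ (χ n x : ℂ) • f x, by
    simp only [Complex.coe_smul]
    exact (hχ n).smul hf, by
    simp only [Complex.coe_smul]
    exact (hχs n).smul_right, by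
    simp only [Complex.coe_smul]
    exact fun x hx hx0 ↦ hχ0 n (Set.mem_singleton_iff.1 hx0 ▸ tsupport_smul_subset_left _ _ hx)⟩
  have hφ (n : ℕ) (x : Space) : φ n x = (χ n x : ℂ) • f x := rfl
  have hφd (n : ℕ) {x : Space} (hx : x ≠ 0) (j : Fin 3) :
      ‖partialDeriv j (φ n) x‖ ≤ ‖partialDeriv j f x‖ + C * (‖x‖⁻¹ * ‖f x‖) := by
    change ‖partialDeriv j (fun x ↦ (χ n x : ℂ) • f x) x‖ ≤ _
    rw [partialDeriv_smul ((hχ n).differentiable (by simp) x) (hf.differentiable (by simp) x)]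
    refine (norm_add_le _ _).trans (add_le_add ?_ ?_)
    · rw [norm_smul, Complex.norm_real, Real.norm_eq_abs]
      exact mul_le_of_le_one_left (norm_nonneg _) (hχ1 n x)
    · rw [norm_smul, Complex.norm_real, ← mul_assoc]
      gcongr
      have := (fderiv ℝ (χ n) x).le_opNorm (EuclideanSpace.single j 1)
      exact (this.trans_eq (by simp)).trans (hχd n x hx)
  have hevent {x : Space} (hx : x ≠ 0) : ∀ᶠ n in atTop, (φ n : Space → Spinor) =ᶠ[𝓝 x] f := by
    filter_upwards [hχlim x hx] with n hn
    filter_upwards [hn] with y hy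
    rw [hφ, hy, Complex.ofReal_one, one_smul]
  have hψ : MemLp (fun x ↦ ‖ψ x‖) 2 := (Lp.memLp ψ).norm
  have hη : MemLp (fun x ↦ ‖η x‖) 2 := (Lp.memLp η).norm
  let g : Space → ℝ := fun x ↦
    (∑ j, (‖partialDeriv j f x‖ + C * (‖x‖⁻¹ * ‖f x‖))) + |m| * ‖f x‖
  have hg : MemLp g 2 := (memLp_finsetSum _ fun j _ ↦ (hfd j).norm.add (hfr.const_mul C)).add
    (hf2.norm.const_mul |m|)
  have lim1 : Tendsto (fun n ↦ ∫ x, ⟪diracFun m 0 0 0 (φ n) x, ψ x⟫_ℂ) atTop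
      (𝓝 (∫ x, ⟪diracFun m 0 0 0 f x, ψ x⟫_ℂ)) := by
    refine tendsto_integral_of_dominated_convergence (fun x ↦ g x * ‖ψ x‖) (fun n ↦ ?_)
      (hg.integrable_mul hψ) (fun n ↦ ?_) ?_
    · exact (memLp_diracFun m 0 0 0 (φ n)).aestronglyMeasurable.inner (Lp.aestronglyMeasurable ψ)
    · filter_upwards [ae_ne_zero] with x hx
      refine (norm_inner_le_norm _ _).trans (mul_le_mul_of_nonneg_right ?_ (norm_nonneg _))
      refine (norm_diracFun_free_le m (φ n) x).trans (add_le_add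
        (Finset.sum_le_sum fun j _ ↦ hφd n hx j) (mul_le_mul_of_nonneg_left ?_ (abs_nonneg m)))
      rw [hφ, norm_smul, Complex.norm_real, Real.norm_eq_abs]
      exact mul_le_of_le_one_left (norm_nonneg _) (hχ1 n x)
    · filter_upwards [ae_ne_zero] with x hx
      refine tendsto_const_nhds.congr' ?_
      filter_upwards [hevent hx] with n hn
      simp only [diracFun_free, partialDeriv, hn.fderiv_eq, hn.eq_of_nhds]
  have lim2 : Tendsto (fun n ↦ ∫ x, ⟪φ n x, η x⟫_ℂ) atTop (𝓝 (∫ x, ⟪f x, η x⟫_ℂ)) := by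
    refine tendsto_integral_of_dominated_convergence (fun x ↦ ‖f x‖ * ‖η x‖) (fun n ↦ ?_)
      (hf2.norm.integrable_mul hη) (fun n ↦ ?_) ?_
    · exact (memLp_testFunction (φ n)).aestronglyMeasurable.inner (Lp.aestronglyMeasurable η)
    · refine .of_forall fun x ↦ (norm_inner_le_norm _ _).trans
        (mul_le_mul_of_nonneg_right ?_ (norm_nonneg _))
      rw [hφ, norm_smul, Complex.norm_real, Real.norm_eq_abs]
      exact mul_le_of_le_one_left (norm_nonneg _) (hχ1 n x)
    · filter_upwards [ae_ne_zero] with x hx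
      refine tendsto_const_nhds.congr' ?_
      filter_upwards [hevent hx] with n hn
      rw [hn.eq_of_nhds]
  refine tendsto_nhds_unique (lim1.congr fun n ↦ ?_) lim2
  rw [← inner_diracTest_eq_integral, h, inner_testToL2_eq_integral]

theorem memLp_norm_inv_mul_norm {f : Space → Spinor} (hf : Continuous f) (hf2 : MemLp f 2) :
    MemLp (fun x ↦ ‖x‖⁻¹ * ‖f x‖) 2 := by
  let θ : ContDiffBump (0 : Space) := ⟨1, 2, one_pos, one_lt_two⟩
  have hθ : Continuous θ := (θ.contDiff (n := 0)).continuous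
  have h1 : MemLp (fun x ↦ ((‖x‖⁻¹ : ℝ) : ℂ) • (θ x • f x)) 2 :=
    memLp_smul_of_norm_le_inv (by fun_prop) (C := 1) (by simp) (hθ.smul hf)
      θ.hasCompactSupport.smul_right
  have hm : AEStronglyMeasurable (fun x : Space ↦ ‖x‖⁻¹ * ‖f x‖) :=
    (measurable_norm.inv.mul hf.norm.measurable).aestronglyMeasurable
  refine (h1.norm.add hf2.norm).of_le_mul (c := 1) hm (.of_forall fun x ↦ ?_)
  rw [one_mul, Pi.add_apply, norm_mul, norm_inv, norm_norm, norm_norm, norm_smul, norm_smul,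
    Complex.norm_real, norm_inv, norm_norm, Real.norm_eq_abs, Real.norm_eq_abs,
    abs_of_nonneg θ.nonneg, abs_of_nonneg (by have := θ.nonneg (x := x); positivity)]
  rcases le_total ‖x‖ 1 with hx | hx
  · rw [θ.one_of_mem_closedBall (by simpa using hx), one_mul]
    linarith [norm_nonneg (f x)]
  · have h2 : ‖x‖⁻¹ * ‖f x‖ ≤ ‖f x‖ :=
      mul_le_of_le_one_left (norm_nonneg _) (inv_le_one_of_one_le₀ hx)
    have h3 : 0 ≤ ‖x‖⁻¹ * (θ x * ‖f x‖) := by have := θ.nonneg (x := x); positivity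
    linarith

end DiracOp

end

noncomputable section

namespace DiracOp

open scoped InnerProductSpace LineDeriv Laplacian

/-! ### The free Dirac equation for tempered distributions -/

/-- The coordinate directions of `ℝ³`. -/
abbrev dir (j : Fin 3) : Space := EuclideanSpace.single j 1

/-- The free Dirac equation `(-i α · ∇ + m β) ψ = η` in the sense of tempered distributions, tested
against scalar Schwartz functions; the sign of `i` is reversed because the derivative falls on the
test function. -/
def IsTemperedDirac (m : ℝ) (ψ η : L2) : Prop :=
  ∀ χ : 𝓢(Space, ℂ), Complex.I • (∑ j, alphaL j ((ψ : 𝓢'(Space, Spinor)) (∂_{dir j} χ)))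
    + (m : ℂ) • betaL ((ψ : 𝓢'(Space, Spinor)) χ) = (η : 𝓢'(Space, Spinor)) χ

theorem integrable_schwartz_smul (χ : 𝓢(Space, ℂ)) (ψ : L2) : Integrable fun x ↦ χ x • ψ x :=
  memLp_one_iff_integrable.1 ((Lp.memLp ψ).smul (χ.memLp 2 volume))

theorem inner_clm_toTemperedDistribution (A : Spinor →L[ℂ] Spinor) (v : Spinor) (χ : 𝓢(Space, ℂ))
    (ψ : L2) :
    ⟪v, A ((ψ : 𝓢'(Space, Spinor)) χ)⟫_ℂ = ∫ x, χ x * ⟪v, A (ψ x)⟫_ℂ := by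
  rw [Lp.toTemperedDistribution_apply,
    ← ContinuousLinearMap.integral_comp_comm A (integrable_schwartz_smul χ ψ),
    ← integral_inner (A.integrable_comp (integrable_schwartz_smul χ ψ))]
  simp only [map_smul, inner_smul_right]

theorem integrable_schwartz_mul_inner (A : Spinor →L[ℂ] Spinor) (v : Spinor) (χ : 𝓢(Space, ℂ))
    (ψ : L2) : Integrable fun x ↦ χ x * ⟪v, A (ψ x)⟫_ℂ := by
  have := (A.integrable_comp (integrable_schwartz_smul χ ψ)).const_inner (𝕜 := ℂ) v
  simpa only [map_smul, inner_smul_right] using this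

/-- The spinor field `conj χ • v`. The conjugate compensates for the inner product being
conjugate-linear in its first argument. -/
def conjSmul (χ : 𝓢(Space, ℂ)) (v : Spinor) (x : Space) : Spinor := (starRingEnd ℂ) (χ x) • v

theorem contDiff_conjSmul (χ : 𝓢(Space, ℂ)) (v : Spinor) : ContDiff ℝ ∞ (conjSmul χ v) :=
  (Complex.conjCLE.contDiff.comp (χ.smooth ⊤)).smul contDiff_const

theorem partialDeriv_conjSmul (χ : 𝓢(Space, ℂ)) (v : Spinor) (j : Fin 3) :
    partialDeriv j (conjSmul χ v) = conjSmul (∂_{dir j} χ) v := by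
  funext x
  have h1 : HasFDerivAt (fun y ↦ Complex.conjCLE (χ y)) _ x :=
    Complex.conjCLE.hasFDerivAt.comp x (χ.differentiable x).hasFDerivAt
  have h2 := (h1.smul (hasFDerivAt_const v x)).fderiv
  rw [conjSmul, SchwartzMap.lineDerivOp_apply_eq_fderiv]
  change fderiv ℝ ((fun y ↦ Complex.conjCLE (χ y)) • fun _ ↦ v) x _ = _
  rw [h2]
  simp

theorem memLp_conjSmul (χ : 𝓢(Space, ℂ)) (v : Spinor) : MemLp (conjSmul χ v) 2 :=
  (χ.memLp 2 volume).of_le_mul (c := ‖v‖)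
    (contDiff_conjSmul χ v).continuous.aestronglyMeasurable
    (.of_forall fun x ↦ by rw [conjSmul, norm_smul, RCLike.norm_conj, mul_comm])

theorem integral_inner_conjSmul (χ : 𝓢(Space, ℂ)) (v : Spinor) (η : L2) :
    ∫ x, ⟪conjSmul χ v x, η x⟫_ℂ = ⟪v, (η : 𝓢'(Space, Spinor)) χ⟫_ℂ := by
  have := inner_clm_toTemperedDistribution (.id ℂ Spinor) v χ η
  simp only [ContinuousLinearMap.id_apply] at this
  rw [this]
  simp only [conjSmul, inner_smul_left, Complex.conj_conj]

theorem integral_inner_diracFun_conjSmul (m : ℝ) (χ : 𝓢(Space, ℂ)) (v : Spinor) (ψ : L2) :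
    ∫ x, ⟪diracFun m 0 0 0 (conjSmul χ v) x, ψ x⟫_ℂ =
      ⟪v, Complex.I • (∑ j, alphaL j ((ψ : 𝓢'(Space, Spinor)) (∂_{dir j} χ)))
        + (m : ℂ) • betaL ((ψ : 𝓢'(Space, Spinor)) χ)⟫_ℂ := by
  rw [inner_add_right, inner_smul_right, inner_smul_right, inner_sum,
    inner_clm_toTemperedDistribution]
  simp only [inner_clm_toTemperedDistribution]
  rw [← integral_finsetSum _ fun j _ ↦ integrable_schwartz_mul_inner _ _ _ _,
    ← integral_const_mul, ← integral_const_mul, ← integral_add]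
  · refine integral_congr_ae (.of_forall fun x ↦ ?_)
    simp only [diracFun_free, partialDeriv_conjSmul, conjSmul, map_smul, inner_add_left,
      inner_smul_left, sum_inner, inner_alphaL, inner_betaL]
    simp
  · exact (integrable_finsetSum _ fun j _ ↦ integrable_schwartz_mul_inner _ _ _ _).const_mul _
  · exact (integrable_schwartz_mul_inner _ _ _ _).const_mul _

/-- The origin is removable for the free Dirac equation in `L²`. -/
theorem isTemperedDirac_of_punctured {m : ℝ} {ψ η : L2}
    (h : ∀ φ : 𝓓(punctured, Spinor),
      ⟪diracTest m 0 0 0 punctured φ, ψ⟫_ℂ = ⟪testToL2 punctured φ, η⟫_ℂ) :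
    IsTemperedDirac m ψ η := by
  intro χ
  refine ext_inner_left ℂ fun v ↦ ?_
  rw [← integral_inner_diracFun_conjSmul, ← integral_inner_conjSmul]
  refine integral_inner_diracFun_of_punctured h (contDiff_conjSmul χ v) (memLp_conjSmul χ v)
    (fun j ↦ ?_) (memLp_norm_inv_mul_norm (contDiff_conjSmul χ v).continuous (memLp_conjSmul χ v))
  rw [partialDeriv_conjSmul]
  exact memLp_conjSmul _ v

/-- The tempered equation may be tested against spinor-valued test functions, one component at a
time. -/
theorem IsTemperedDirac.inner_diracTest {m : ℝ} {ψ η : L2} (h : IsTemperedDirac m ψ η)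
    {Ω : TopologicalSpace.Opens Space} (φ : 𝓓(Ω, Spinor)) :
    ⟪diracTest m 0 0 0 Ω φ, ψ⟫_ℂ = ⟪testToL2 Ω φ, η⟫_ℂ := by
  let e (k : Fin 4) : Spinor := EuclideanSpace.single k 1
  let A (k : Fin 4) : Spinor →L[ℂ] Spinor := (EuclideanSpace.proj (𝕜 := ℂ) k).smulRight (e k)
  let φk (k : Fin 4) : 𝓓(Ω, Spinor) := TestFunction.postcompCLM (A k) φ
  have hφ : φ = ∑ k, φk k := by
    ext x i
    simp [φk, A, e, TestFunction.postcompCLM_apply, Pi.single_apply]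
  have hs (k : Fin 4) : HasCompactSupport fun x ↦ (starRingEnd ℂ) (φ x k) :=
    φ.hasCompactSupport.comp_left (g := fun v : Spinor ↦ (starRingEnd ℂ) (v k)) (by simp)
  have hc (k : Fin 4) : ContDiff ℝ ∞ fun x ↦ (starRingEnd ℂ) (φ x k) :=
    Complex.conjCLE.contDiff.comp
      (((EuclideanSpace.proj (𝕜 := ℂ) k).restrictScalars ℝ).contDiff.comp φ.contDiff)
  have hk (k : Fin 4) : (φk k : Space → Spinor) = conjSmul ((hs k).toSchwartzMap (hc k)) (e k) := by
    funext x
    simp [φk, conjSmul, A, TestFunction.postcompCLM_apply]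
  rw [hφ, map_sum, map_sum, sum_inner, sum_inner]
  refine Finset.sum_congr rfl fun k _ ↦ ?_
  rw [inner_diracTest_eq_integral, inner_testToL2_eq_integral, hk,
    integral_inner_diracFun_conjSmul, integral_inner_conjSmul, h]

/-- Squaring the free Dirac equation gives `-Δ ψ + m² ψ` on the left-hand side. -/
theorem IsTemperedDirac.sq {m : ℝ} {ψ η : L2} (h : IsTemperedDirac m ψ η) (χ : 𝓢(Space, ℂ)) :
    Complex.I • (∑ j, alphaL j ((η : 𝓢'(Space, Spinor)) (∂_{dir j} χ)))
      + (m : ℂ) • betaL ((η : 𝓢'(Space, Spinor)) χ) =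
      (m ^ 2 : ℂ) • (ψ : 𝓢'(Space, Spinor)) χ - (Δ (ψ : 𝓢'(Space, Spinor))) χ := by
  let b := EuclideanSpace.basisFun (Fin 3) ℝ
  have hΔ : (Δ (ψ : 𝓢'(Space, Spinor))) χ =
      ∑ j, (ψ : 𝓢'(Space, Spinor)) (∂_{dir j} (∂_{dir j} χ)) := by
    rw [TemperedDistribution.laplacian_apply_apply, SchwartzMap.laplacian_eq_sum b, map_sum]
    simp [b]
  have hcomm (j k : Fin 3) : ∂_{dir j} (∂_{dir k} χ) = ∂_{dir k} (∂_{dir j} χ) := by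
    ext x
    have hd : DifferentiableAt ℝ (fderiv ℝ χ) x :=
      ((χ.smooth 2).fderiv_right (m := 1) le_rfl).differentiable one_ne_zero x
    have h2 (i l : Fin 3) : (∂_{dir i} (∂_{dir l} χ)) x =
        fderiv ℝ (fderiv ℝ χ) x (dir i) (dir l) := by
      have := (hd.hasFDerivAt.clm_apply (hasFDerivAt_const (dir l) x)).fderiv
      rw [SchwartzMap.lineDerivOp_apply_eq_fderiv]
      have e : ((∂_{dir l} χ : 𝓢(Space, ℂ)) : Space → ℂ) = fun y ↦ fderiv ℝ χ y (dir l) :=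
        funext fun y ↦ SchwartzMap.lineDerivOp_apply_eq_fderiv _ _ _
      rw [e, this]
      simp
    rw [h2, h2]
    exact ((χ.smooth 2).contDiffAt.isSymmSndFDerivAt (by simp)) _ _
  have h' (χ : 𝓢(Space, ℂ)) := (h χ).symm
  rw [hΔ]
  simp only [h', map_add, map_smul, betaL_betaL, alphaL_betaL, Fin.sum_univ_three,
    alphaL_alphaL_self]
  rw [hcomm 1 0, hcomm 2 0, hcomm 2 1, alphaL_alphaL_of_ne (j := 1) (k := 0) (by decide),
    alphaL_alphaL_of_ne (j := 2) (k := 0) (by decide),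
    alphaL_alphaL_of_ne (j := 2) (k := 1) (by decide)]
  simp only [smul_add, smul_smul, Complex.I_mul_I, smul_neg]
  module

/-! ### Elliptic regularity -/

open TemperedDistribution

theorem clm_compLp_toTemperedDistribution (A : Spinor →L[ℂ] Spinor) (ψ : L2) (χ : 𝓢(Space, ℂ)) :
    ((A.compLp ψ : L2) : 𝓢'(Space, Spinor)) χ = A ((ψ : 𝓢'(Space, Spinor)) χ) := by
  rw [Lp.toTemperedDistribution_apply, Lp.toTemperedDistribution_apply,
    ← ContinuousLinearMap.integral_comp_comm A (integrable_schwartz_smul χ ψ)]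
  refine integral_congr_ae ?_
  filter_upwards [A.coeFn_compLp ψ] with x hx
  rw [hx, map_smul]

theorem memSobolev_zero (ψ : L2) : MemSobolev 0 2 (ψ : 𝓢'(Space, Spinor)) :=
  memSobolev_zero_iff.2 ⟨ψ, rfl⟩

theorem fourierMultiplierCLM_add_norm_sq (a : ℝ) (f : 𝓢'(Space, Spinor)) :
    fourierMultiplierCLM Spinor (fun x : Space ↦ ((a + ‖x‖ ^ 2 : ℝ) : ℂ)) f =
      (a : ℂ) • f - ((2 * Real.pi : ℂ) ^ 2)⁻¹ • Δ f := by
  have h1 : (fun x : Space ↦ ((a + ‖x‖ ^ 2 : ℝ) : ℂ)) =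
      (fun _ ↦ (a : ℂ)) + fun x ↦ Complex.ofReal (‖x‖ ^ 2) := by
    ext x
    simp
  have h2 (g₁ g₂ : Space → ℂ) (hg₁ : g₁.HasTemperateGrowth) (hg₂ : g₂.HasTemperateGrowth) :
      fourierMultiplierCLM Spinor (g₁ + g₂) f =
        fourierMultiplierCLM Spinor g₁ f + fourierMultiplierCLM Spinor g₂ f := by
    simp only [fourierMultiplierCLM_apply, smulLeftCLM_add hg₁ hg₂, add_apply,
      FourierTransform.fourierInv_add]
  rw [h1, h2 _ _ (by fun_prop) (by fun_prop), laplacian_eq_fourierMultiplierCLM,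
    fourierMultiplierCLM_const]
  have hπ : (2 * Real.pi : ℂ) ^ 2 ≠ 0 := by
    simp [Real.pi_ne_zero]
  have h3 (g : 𝓢'(Space, Spinor)) :
      (-(2 * Real.pi) ^ 2 : ℝ) • g = (-(2 * Real.pi : ℂ) ^ 2) • g := by
    ext1 χ
    rw [smul_apply, smul_apply, ← Complex.coe_smul]
    push_cast
    rfl
  rw [h3, smul_smul, mul_neg, inv_mul_cancel₀ hπ, neg_smul, one_smul, sub_neg_eq_add]
  rfl

theorem besselPotential_two_eq (f : 𝓢'(Space, Spinor)) :
    besselPotential Space Spinor 2 f = f - ((2 * Real.pi : ℂ) ^ 2)⁻¹ • Δ f := by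
  have := fourierMultiplierCLM_add_norm_sq 1 f
  rw [Complex.ofReal_one, one_smul] at this
  rw [← this, besselPotential]
  simp

/-- Elliptic regularity for the free Dirac operator: `(1 - Δ) ψ` lies in `H⁻¹`. -/
theorem IsTemperedDirac.memSobolev {m : ℝ} {ψ η : L2} (h : IsTemperedDirac m ψ η) :
    MemSobolev 1 2 (ψ : 𝓢'(Space, Spinor)) := by
  have hη : Δ (ψ : 𝓢'(Space, Spinor)) = (m ^ 2 : ℂ) • (ψ : 𝓢'(Space, Spinor))
      + Complex.I • (∑ j, ∂_{dir j} (((alphaL j).compLp η : L2) : 𝓢'(Space, Spinor)))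
      - (m : ℂ) • ((betaL.compLp η : L2) : 𝓢'(Space, Spinor)) := by
    ext1 χ
    have := h.sq χ
    simp only [sub_apply, add_apply, smul_apply, sum_apply, lineDerivOp_apply_apply, map_neg,
      clm_compLp_toTemperedDistribution, Finset.sum_neg_distrib, smul_neg]
    rw [← sub_eq_zero] at this ⊢
    rw [← this]
    module
  have hm : MemSobolev (-1) 2 (Δ (ψ : 𝓢'(Space, Spinor))) := by
    have h0 (f : L2) : MemSobolev (-1) 2 (f : 𝓢'(Space, Spinor)) :=
      (memSobolev_zero f).mono (by norm_num)
    have hd (j : Fin 3) (f : L2) : MemSobolev (-1) 2 (∂_{dir j} (f : 𝓢'(Space, Spinor))) := by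
      have := (memSobolev_zero f).lineDerivOp (m := dir j)
      rwa [zero_sub] at this
    rw [hη, Fin.sum_univ_three]
    exact (((h0 ψ).smul _).add ((((hd 0 _).add (hd 1 _)).add (hd 2 _)).smul _)).sub
      ((h0 _).smul _)
  have h2 : MemSobolev (-1) 2 (besselPotential Space Spinor 2 (ψ : 𝓢'(Space, Spinor))) := by
    rw [besselPotential_two_eq]
    exact ((memSobolev_zero ψ).mono (by norm_num)).sub (hm.smul _)
  rw [memSobolev_besselPotential_iff] at h2
  norm_num at h2
  exact h2

theorem exists_isTemperedDirac_of_memSobolev (m : ℝ) {ψ : L2}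
    (h : MemSobolev 1 2 (ψ : 𝓢'(Space, Spinor))) : ∃ η, IsTemperedDirac m ψ η := by
  have hd (j : Fin 3) : ∃ f : L2, ∂_{dir j} (ψ : 𝓢'(Space, Spinor)) = (f : 𝓢'(Space, Spinor)) := by
    have := h.lineDerivOp (m := dir j)
    rwa [sub_self, memSobolev_zero_iff] at this
  choose f hf using hd
  refine ⟨(-Complex.I) • (∑ j, (alphaL j).compLp (f j)) + (m : ℂ) • betaL.compLp ψ, fun χ ↦ ?_⟩
  have hj (j : Fin 3) : (ψ : 𝓢'(Space, Spinor)) (∂_{dir j} χ) = -(f j : 𝓢'(Space, Spinor)) χ := by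
    rw [← hf, lineDerivOp_apply_apply, map_neg, neg_neg]
  simp only [hj, map_neg]
  rw [← Lp.toTemperedDistributionCLM_apply (_ + _)]
  simp only [map_add, map_smul, map_sum, Lp.toTemperedDistributionCLM_apply]
  simp [clm_compLp_toTemperedDistribution, -Lp.toTemperedDistribution_apply]

theorem hasTemperateGrowth_inv_add_norm_sq {a : ℝ} (ha : 0 < a) :
    (fun x : Space ↦ (((a + ‖x‖ ^ 2)⁻¹ : ℝ) : ℂ)).HasTemperateGrowth := by
  have h1 := (Function.hasTemperateGrowth_one_add_norm_sq_rpow Space (-1)).comp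
    ((Real.sqrt a)⁻¹ • ContinuousLinearMap.id ℝ Space).hasTemperateGrowth
  have h2 : (fun x : Space ↦ ((a⁻¹ * ((fun y : Space ↦ (1 + ‖y‖ ^ 2) ^ (-1 : ℝ)) ∘
      ((Real.sqrt a)⁻¹ • ContinuousLinearMap.id ℝ Space)) x : ℝ) : ℂ)).HasTemperateGrowth := by
    fun_prop
  convert h2 using 2 with x
  simp only [Function.comp_apply]
  congr 1
  have hs : (Real.sqrt a)⁻¹ ^ 2 = a⁻¹ := by rw [inv_pow, Real.sq_sqrt ha.le]
  simp only [smul_apply, ContinuousLinearMap.id_apply, norm_smul, mul_pow,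
    Real.norm_eq_abs, sq_abs, hs, Real.rpow_neg_one]
  rw [← mul_inv, mul_add, mul_one, mul_inv_cancel_left₀ ha.ne']

/-- `Δ f = 4π² a f` has no nonzero tempered solution for `a > 0`: the symbol `a + |ξ|²` is
invertible. -/
theorem eq_zero_of_laplacian_eq {a : ℝ} (ha : 0 < a) {f : 𝓢'(Space, Spinor)}
    (h : Δ f = (((2 * Real.pi) ^ 2 * a : ℝ) : ℂ) • f) : f = 0 := by
  have hπ : (2 * Real.pi : ℂ) ^ 2 ≠ 0 := by
    simp [Real.pi_ne_zero]
  have h1 := fourierMultiplierCLM_add_norm_sq a f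
  rw [h, smul_smul, Complex.ofReal_mul, Complex.ofReal_pow, Complex.ofReal_mul,
    Complex.ofReal_ofNat,
    inv_mul_cancel_left₀ hπ, sub_self] at h1
  have h2 := congrArg (fourierMultiplierCLM Spinor
    fun x : Space ↦ (((a + ‖x‖ ^ 2)⁻¹ : ℝ) : ℂ)) h1
  rw [map_zero, fourierMultiplierCLM_fourierMultiplierCLM_apply (by fun_prop)
    (hasTemperateGrowth_inv_add_norm_sq ha)] at h2
  have h3 : ((fun x : Space ↦ ((a + ‖x‖ ^ 2 : ℝ) : ℂ)) *
      fun x : Space ↦ (((a + ‖x‖ ^ 2)⁻¹ : ℝ) : ℂ)) = fun _ ↦ 1 := by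
    ext x
    rw [Pi.mul_apply, ← Complex.ofReal_mul, mul_inv_cancel₀ (by positivity), Complex.ofReal_one]
  rw [h3, fourierMultiplierCLM_const] at h2
  simpa using h2

theorem eq_zero_of_toTemperedDistribution_eq_zero {ψ : L2} (h : (ψ : 𝓢'(Space, Spinor)) = 0) :
    ψ = 0 := by
  have := Lp.ker_toTemperedDistributionCLM_eq_bot (F := Spinor) (μ := (volume : Measure Space))
    (p := 2)
  exact LinearMap.ker_eq_bot'.1 this ψ h

/-- The free Dirac operator does not have the eigenvalues `± i`, since its square `-Δ + m²` does not
have the eigenvalue `-1`. -/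
theorem IsTemperedDirac.eq_zero {m : ℝ} {ψ : L2} {c : ℂ} (hc : c ^ 2 = -1)
    (h : IsTemperedDirac m ψ (c • ψ)) : ψ = 0 := by
  have hsmul (χ : 𝓢(Space, ℂ)) : ((c • ψ : L2) : 𝓢'(Space, Spinor)) χ =
      c • (ψ : 𝓢'(Space, Spinor)) χ := by
    rw [← Lp.toTemperedDistributionCLM_apply, map_smul]
    rfl
  have ha : 0 < (m ^ 2 + 1) / (2 * Real.pi) ^ 2 := by positivity
  refine eq_zero_of_toTemperedDistribution_eq_zero (eq_zero_of_laplacian_eq ha ?_)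
  rw [mul_div_cancel₀ _ (by positivity)]
  ext1 χ
  have h1 := h.sq χ
  have h2 := h χ
  simp only [hsmul, map_smul] at h1 h2
  rw [smul_comm _ c, ← Finset.smul_sum, smul_comm _ c, ← smul_add, h2, smul_smul,
    ← pow_two, hc] at h1
  rw [smul_apply]
  push_cast
  rw [add_smul, one_smul, ← sub_eq_zero]
  rw [← sub_eq_zero] at h1
  rw [← h1]
  module

end DiracOp

end

noncomputable section

namespace DiracOp

open scoped InnerProductSpace

/-! ### Symmetry and density -/

variable {Ω : TopologicalSpace.Opens Space}

theorem inner_diracTest_symm (m μ : ℝ) (φ χ : 𝓓(Ω, Spinor)) :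
    ⟪diracTest m 0 μ 0 Ω φ, testToL2 Ω χ⟫_ℂ = ⟪testToL2 Ω φ, diracTest m 0 μ 0 Ω χ⟫_ℂ := by
  have hφ : ContDiff ℝ 2 φ := mod_cast contDiff_infty.1 φ.contDiff 2
  have hχ : ContDiff ℝ 2 χ := mod_cast contDiff_infty.1 χ.contDiff 2
  have hαχ (j : Fin 3) : ContDiff ℝ 2 fun x ↦ alphaL j (χ x) :=
    ((alphaL j).restrictScalars ℝ).contDiff.comp hχ
  have hA : ⟪diracTest m 0 μ 0 Ω φ, testToL2 Ω χ⟫_ℂ =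
      ∫ x, ⟪diracFun m 0 μ 0 φ x, χ x⟫_ℂ := by
    rw [inner_diracTest_eq_integral]
    exact integral_congr_ae ((memLp_testFunction χ).coeFn_toLp.mono fun x hx ↦
      congrArg (fun v ↦ ⟪diracFun m 0 μ 0 φ x, v⟫_ℂ) hx)
  have hB : ⟪testToL2 Ω φ, diracTest m 0 μ 0 Ω χ⟫_ℂ =
      ∫ x, ⟪φ x, diracFun m 0 μ 0 χ x⟫_ℂ := by
    rw [inner_testToL2_eq_integral]
    exact integral_congr_ae ((memLp_diracFun m 0 μ 0 χ).coeFn_toLp.mono fun x hx ↦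
      congrArg (fun v ↦ ⟪φ x, v⟫_ℂ) hx)
  have hpart (j : Fin 3) : Continuous (partialDeriv j φ) :=
    (contDiff_partialDeriv (n := 1) hφ j).continuous
  have hpart' (j : Fin 3) : Continuous (partialDeriv j fun x ↦ alphaL j (χ x)) :=
    (contDiff_partialDeriv (n := 1) (hαχ j) j).continuous
  have hi1 (j : Fin 3) : Integrable fun x ↦ ⟪partialDeriv j φ x, alphaL j (χ x)⟫_ℂ :=
    integrable_inner_of_hasCompactSupport (hpart j) (hαχ j).continuous
      (hasCompactSupport_partialDeriv φ.hasCompactSupport j)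
  have hi2 (j : Fin 3) :
      Integrable fun x ↦ ⟪φ x, partialDeriv j (fun x ↦ alphaL j (χ x)) x⟫_ℂ :=
    integrable_inner_of_hasCompactSupport hφ.continuous (hpart' j) φ.hasCompactSupport
  -- the integrand of the difference is `i ∑ⱼ ∂ⱼ ⟨φ, αⱼ χ⟩`
  have hpt (x : Space) : ⟪diracFun m 0 μ 0 φ x, χ x⟫_ℂ - ⟪φ x, diracFun m 0 μ 0 χ x⟫_ℂ =
      Complex.I * ∑ j, (⟪partialDeriv j φ x, alphaL j (χ x)⟫_ℂ
        + ⟪φ x, partialDeriv j (fun x ↦ alphaL j (χ x)) x⟫_ℂ) := by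
    have h1 (j : Fin 3) : partialDeriv j (fun x ↦ alphaL j (χ x)) x =
        alphaL j (partialDeriv j χ x) :=
      partialDeriv_clm_comp _ (hχ.differentiable two_ne_zero x) j
    simp only [diracFun_scalar, h1, inner_add_left, inner_add_right, inner_smul_left,
      inner_smul_right, sum_inner, inner_sum, inner_alphaL, inner_betaL, map_smul, map_neg,
      Complex.conj_I, Complex.conj_ofReal, Finset.sum_add_distrib]
    ring
  have hintA : Integrable fun x ↦ ⟪diracFun m 0 μ 0 φ x, χ x⟫_ℂ := by
    refine (L2.integrable_inner (𝕜 := ℂ) (diracTest m 0 μ 0 Ω φ) (testToL2 Ω χ)).congr ?_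
    filter_upwards [(memLp_diracFun m 0 μ 0 φ).coeFn_toLp, (memLp_testFunction χ).coeFn_toLp]
      with x h1 h2
    exact congrArg₂ (fun v w ↦ ⟪v, w⟫_ℂ) h1 h2
  have hintB : Integrable fun x ↦ ⟪φ x, diracFun m 0 μ 0 χ x⟫_ℂ := by
    refine (L2.integrable_inner (𝕜 := ℂ) (testToL2 Ω φ) (diracTest m 0 μ 0 Ω χ)).congr ?_
    filter_upwards [(memLp_diracFun m 0 μ 0 χ).coeFn_toLp, (memLp_testFunction φ).coeFn_toLp]
      with x h1 h2
    exact congrArg₂ (fun v w ↦ ⟪v, w⟫_ℂ) h2 h1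
  rw [hA, hB, ← sub_eq_zero, ← integral_sub hintA hintB]
  simp_rw [hpt]
  rw [integral_const_mul, integral_finsetSum, Finset.sum_eq_zero, mul_zero]
  swap
  · exact fun j _ ↦ (hi1 j).add (hi2 j)
  intro j _
  rw [integral_add (hi1 j) (hi2 j), integral_inner_partialDeriv (hφ.of_le (by norm_num))
    ((hαχ j).of_le (by norm_num)) φ.hasCompactSupport, neg_add_cancel]

theorem forall_diracMin_domain {m ν μ lam : ℝ} {p : (diracMin m ν μ lam Ω).domain → Prop} :
    (∀ x, p x) ↔ ∀ φ, p ⟨testToL2 Ω φ, mem_diracMin_domain m ν μ lam φ⟩ := by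
  refine ⟨fun h φ ↦ h _, ?_⟩
  rintro h ⟨_, φ, rfl⟩
  exact h φ

theorem diracMin_isFormalAdjoint (m μ : ℝ) (Ω : TopologicalSpace.Opens Space) :
    (diracMin m 0 μ 0 Ω).IsFormalAdjoint (diracMin m 0 μ 0 Ω) := by
  refine forall_diracMin_domain.2 fun φ ↦ forall_diracMin_domain.2 fun χ ↦ ?_
  rw [diracMin_apply, diracMin_apply]
  exact inner_diracTest_symm m μ _ _

/-- Test functions on the punctured space are dense: a vector orthogonal to all of them is `D 0` in
the distributional sense on the punctured space, hence on the whole space. -/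
theorem dense_diracMin_punctured (m μ : ℝ) :
    Dense ((diracMin m 0 μ 0 punctured).domain : Set L2) := by
  rw [Submodule.dense_iff_topologicalClosure_eq_top, Submodule.topologicalClosure_eq_top_iff,
    Submodule.eq_bot_iff]
  intro u hu
  have h : IsTemperedDirac 0 (0 : L2) u := isTemperedDirac_of_punctured fun φ ↦ by
    rw [inner_zero_right]
    exact (hu _ (mem_diracMin_domain m 0 μ 0 φ)).symm
  refine eq_zero_of_inner_testToL2 fun φ ↦ ?_
  rw [← h.inner_diracTest, inner_zero_right]

theorem diracMin_punctured_le (m ν μ lam : ℝ) :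
    diracMin m ν μ lam punctured ≤ diracMin m ν μ lam ⊤ := by
  have h (φ : 𝓓(punctured, Spinor)) :
      ∃ χ : 𝓓((⊤ : TopologicalSpace.Opens Space), Spinor), (χ : Space → Spinor) = φ :=
    ⟨⟨φ, φ.contDiff, φ.hasCompactSupport, by simp⟩, rfl⟩
  constructor
  · rintro _ ⟨φ, rfl⟩
    obtain ⟨χ, hχ⟩ := h φ
    exact ⟨χ, MemLp.toLp_congr (memLp_testFunction χ) (memLp_testFunction φ) (.of_eq hχ)⟩
  · refine forall_diracMin_domain.2 fun φ ↦ forall_diracMin_domain.2 fun χ hφχ ↦ ?_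
    have e : (φ : Space → Spinor) = χ := by
      have h' : (φ : Space → Spinor) =ᵐ[volume] χ :=
        (MemLp.toLp_eq_toLp_iff (memLp_testFunction φ) (memLp_testFunction χ)).1 hφχ
      exact (φ.continuous.ae_eq_iff_eq volume χ.continuous).1 h'
    rw [diracMin_apply, diracMin_apply]
    exact MemLp.toLp_congr (memLp_diracFun m ν μ lam φ) (memLp_diracFun m ν μ lam χ)
      (.of_eq (by rw [e]))

/-! ### The Coulomb term as a relatively bounded perturbation -/

theorem norm_toLp_sq {f : Space → Spinor} (hf : MemLp f 2) :
    ‖hf.toLp f‖ ^ 2 = ∫ x, ‖f x‖ ^ 2 := by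
  have h : ((‖hf.toLp f‖ ^ 2 : ℝ) : ℂ) = ((∫ x, ‖f x‖ ^ 2 : ℝ) : ℂ) := by
    rw [Complex.ofReal_pow, ← integral_complex_ofReal]
    refine (inner_self_eq_norm_sq_to_K (𝕜 := ℂ) (hf.toLp f)).symm.trans ?_
    rw [L2.inner_def]
    refine integral_congr_ae (hf.coeFn_toLp.mono fun x hx ↦ ?_)
    simp only [hx, inner_self_eq_norm_sq_to_K, Complex.ofReal_pow, Complex.coe_algebraMap]
  exact_mod_cast h

variable (φ : 𝓓(punctured, Spinor))

/-- The Coulomb term is bounded relative to the massless operator, with a constant that does not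
depend on the coupling constant `s` of the latter. -/
theorem norm_diracTest_sub_le (m s t : ℝ) :
    ‖diracTest m 0 t 0 punctured φ - diracTest m 0 s 0 punctured φ‖ ≤
      2 * |t - s| * ‖diracTest 0 0 s 0 punctured φ‖ := by
  refine abs_le_of_sq_le_sq' ?_ (by positivity) |>.2
  have hpt (x : Space) : ‖(diracFun m 0 t 0 φ - diracFun m 0 s 0 φ) x‖ ^ 2 =
      (t - s) ^ 2 * (‖x‖⁻¹ ^ 2 * ‖φ x‖ ^ 2) := by
    have e : (diracFun m 0 t 0 φ - diracFun m 0 s 0 φ) x =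
        ((t - s : ℝ) : ℂ) • betaL (((‖x‖⁻¹ : ℝ) : ℂ) • φ x) := by
      rw [Pi.sub_apply, diracFun_scalar, diracFun_scalar, Complex.ofReal_sub, sub_smul]
      abel
    rw [e, norm_smul, norm_betaL, norm_smul, Complex.norm_real, Complex.norm_real, mul_pow,
      mul_pow, Real.norm_eq_abs, sq_abs, norm_inv, norm_norm]
  change ‖(memLp_diracFun m 0 t 0 φ).toLp _ - (memLp_diracFun m 0 s 0 φ).toLp _‖ ^ 2 ≤
    (2 * |t - s| * ‖(memLp_diracFun 0 0 s 0 φ).toLp _‖) ^ 2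
  rw [← MemLp.toLp_sub, norm_toLp_sq, mul_pow _ ‖_‖, norm_toLp_sq]
  simp_rw [hpt]
  rw [integral_const_mul, mul_pow, sq_abs]
  nlinarith [mul_le_mul_of_nonneg_left (integral_norm_inv_smul_sq_le φ s) (sq_nonneg (t - s))]

theorem norm_diracTest_massless_le (m s : ℝ) :
    ‖diracTest 0 0 s 0 punctured φ‖ ≤
      ‖diracTest m 0 s 0 punctured φ‖ + |m| * ‖testToL2 punctured φ‖ := by
  have h : ‖diracTest 0 0 s 0 punctured φ - diracTest m 0 s 0 punctured φ‖ ^ 2 =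
      (|m| * ‖testToL2 punctured φ‖) ^ 2 := by
    change ‖(memLp_diracFun 0 0 s 0 φ).toLp _ - (memLp_diracFun m 0 s 0 φ).toLp _‖ ^ 2 =
      (|m| * ‖(memLp_testFunction φ).toLp _‖) ^ 2
    rw [← MemLp.toLp_sub, norm_toLp_sq, mul_pow, norm_toLp_sq, ← integral_const_mul]
    refine integral_congr_ae (.of_forall fun x ↦ ?_)
    have e : (diracFun 0 0 s 0 φ - diracFun m 0 s 0 φ) x = -((m : ℂ) • betaL (φ x)) := by
      rw [Pi.sub_apply, diracFun_scalar, diracFun_scalar, Complex.ofReal_zero, zero_smul]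
      abel
    beta_reduce
    rw [e, norm_neg, norm_smul, norm_betaL, Complex.norm_real, Real.norm_eq_abs, mul_pow]
  have h' := (pow_left_inj₀ (norm_nonneg _) (by positivity) two_ne_zero).1 h
  rw [← h', add_comm]
  exact norm_le_norm_sub_add _ _

theorem norm_diracTest_sub_le_mul_norm_add (m s t : ℝ) {c : ℂ}
    (hc : c = Complex.I ∨ c = -Complex.I) :
    ‖diracTest m 0 t 0 punctured φ - diracTest m 0 s 0 punctured φ‖ ≤
      2 * (1 + |m|) * |t - s| *
        ‖diracTest m 0 s 0 punctured φ + c • testToL2 punctured φ‖ := by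
  have hre : c.re = 0 := by rcases hc with rfl | rfl <;> simp
  have hn : ‖c‖ = 1 := by rcases hc with rfl | rfl <;> simp
  have h := norm_add_smul_sq_of_symmetric (inner_diracTest_symm m s φ φ) hre
  rw [hn, one_pow, one_mul] at h
  have h1 : ‖diracTest m 0 s 0 punctured φ‖ ≤
      ‖diracTest m 0 s 0 punctured φ + c • testToL2 punctured φ‖ :=
    abs_le_of_sq_le_sq' (by rw [h]; nlinarith [sq_nonneg ‖testToL2 punctured φ‖])
      (norm_nonneg _) |>.2
  have h2 : ‖testToL2 punctured φ‖ ≤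
      ‖diracTest m 0 s 0 punctured φ + c • testToL2 punctured φ‖ :=
    abs_le_of_sq_le_sq' (by rw [h]; nlinarith [sq_nonneg ‖diracTest m 0 s 0 punctured φ‖])
      (norm_nonneg _) |>.2
  calc _ ≤ 2 * |t - s| * ‖diracTest 0 0 s 0 punctured φ‖ := norm_diracTest_sub_le φ m s t
    _ ≤ 2 * |t - s| * (‖diracTest m 0 s 0 punctured φ + c • testToL2 punctured φ‖ + |m| *
          ‖diracTest m 0 s 0 punctured φ + c • testToL2 punctured φ‖) := by
        gcongr
        exact (norm_diracTest_massless_le φ m s).trans (by gcongr)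
    _ = _ := by ring

/-! ### Essential self-adjointness and the domain of the closure -/

/-- The ranges of `H ± i` on test functions on the punctured space have trivial orthogonal
complement: this holds for the free operator and propagates along `t ↦ t / |x|`, `t` between `0`
and `μ`. -/
theorem eq_zero_of_orthogonal_range_diracTest (m μ : ℝ) {c : ℂ}
    (hc : c = Complex.I ∨ c = -Complex.I) {u : L2}
    (hu : ∀ φ, ⟪diracTest m 0 μ 0 punctured φ + c • testToL2 punctured φ, u⟫_ℂ = 0) : u = 0 := by
  refine eq_zero_of_orthogonal_range_of_path
    (P := fun t ↦ diracTest m 0 t 0 punctured + c • testToL2 punctured)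
    (K := 2 * (1 + |m|)) (by positivity) (fun s t φ ↦ ?_) (fun v hv ↦ ?_) μ u hu
  · simp only [LinearMap.add_apply, LinearMap.smul_apply, add_sub_add_right_eq_sub]
    exact norm_diracTest_sub_le_mul_norm_add φ m s t hc
  · refine IsTemperedDirac.eq_zero (m := m) (c := c) ?_ (isTemperedDirac_of_punctured fun φ ↦ ?_)
    · rcases hc with rfl | rfl <;> simp
    · have h := hv φ
      have hconj : (starRingEnd ℂ) c = -c := by rcases hc with rfl | rfl <;> simp
      rw [LinearMap.add_apply, LinearMap.smul_apply, inner_add_left, inner_smul_left, hconj] at h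
      rw [inner_smul_right]
      linear_combination h

theorem isSelfAdjoint_closure_diracMin_punctured (m μ : ℝ) :
    IsSelfAdjoint (diracMin m 0 μ 0 punctured).closure := by
  refine LinearPMap.isSelfAdjoint_closure_of_orthogonal_range (dense_diracMin_punctured m μ)
    (diracMin_isFormalAdjoint m μ punctured) fun c hc u hu ↦ ?_
  refine eq_zero_of_orthogonal_range_diracTest m μ hc fun φ ↦ ?_
  rw [← diracMin_apply]
  exact hu _

theorem isClosable_diracMin_punctured (m μ : ℝ) : (diracMin m 0 μ 0 punctured).IsClosable :=
  LinearPMap.isClosable_of_symmetric (dense_diracMin_punctured m μ)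
    (diracMin_isFormalAdjoint m μ punctured)

/-- The graph norms for different coupling constants are equivalent. -/
theorem diracMin_closure_domain_le (m s t : ℝ) :
    (diracMin m 0 s 0 punctured).closure.domain ≤
      (diracMin m 0 t 0 punctured).closure.domain := by
  refine LinearPMap.closure_domain_le_of_norm_le (isClosable_diracMin_punctured m s)
    (isClosable_diracMin_punctured m t) rfl
    (C := 2 * |t - s| * (1 + |m|) + 1) fun x hx hx' ↦ ?_
  obtain ⟨φ, rfl⟩ := hx
  rw [diracMin_apply, diracMin_apply]
  have h1 := norm_diracTest_sub_le φ m s t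
  have h2 := norm_diracTest_massless_le φ m s
  set a := ‖diracTest m 0 s 0 punctured φ‖ with ha
  set b := ‖testToL2 punctured φ‖
  have ha0 : 0 ≤ a := norm_nonneg _
  have hb0 : 0 ≤ b := norm_nonneg _
  calc _ ≤ ‖diracTest m 0 t 0 punctured φ - diracTest m 0 s 0 punctured φ‖ + a :=
        norm_le_norm_sub_add _ _
    _ ≤ 2 * |t - s| * (a + |m| * b) + a := by
        gcongr
        exact h1.trans (by gcongr)
    _ ≤ 2 * |t - s| * ((1 + |m|) * (a + b)) + (a + b) := by
        gcongr
        · nlinarith [abs_nonneg m, mul_nonneg (abs_nonneg m) ha0]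
        · linarith
    _ = _ := by ring

/-- The adjoint of the free operator has domain `H¹`: one inclusion is elliptic regularity. -/
theorem diracMin_free_adjoint_domain (m : ℝ) :
    (diracMin m 0 0 0 punctured).adjoint.domain = sobolevH1 := by
  have hd := dense_diracMin_punctured m 0
  refine le_antisymm (fun ψ hψ ↦ ?_) fun ψ hψ ↦ ?_
  · refine (isTemperedDirac_of_punctured (m := m)
      (η := (diracMin m 0 0 0 punctured).adjoint ⟨ψ, hψ⟩) fun φ ↦ ?_).memSobolev
    have := (LinearPMap.adjoint_isFormalAdjoint hd).symm
      ⟨testToL2 punctured φ, mem_diracMin_domain m 0 0 0 φ⟩ ⟨ψ, hψ⟩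
    rwa [diracMin_apply] at this
  · obtain ⟨η, h⟩ := exists_isTemperedDirac_of_memSobolev m hψ
    refine LinearPMap.mem_adjoint_domain_of_exists _ ⟨η, forall_diracMin_domain.2 fun φ ↦ ?_⟩
    rw [diracMin_apply, ← inner_conj_symm, ← h.inner_diracTest, inner_conj_symm]

theorem diracMin_punctured_closure_domain (m μ : ℝ) :
    (diracMin m 0 μ 0 punctured).closure.domain = sobolevH1 := by
  rw [le_antisymm (diracMin_closure_domain_le m μ 0) (diracMin_closure_domain_le m 0 μ),
    ← diracMin_free_adjoint_domain m, LinearPMap.adjoint_eq_closure_of_isSelfAdjoint_closure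
      (dense_diracMin_punctured m 0) (isClosable_diracMin_punctured m 0)
      (isSelfAdjoint_closure_diracMin_punctured m 0)]

theorem diracMin_top_closure (m μ : ℝ) :
    (diracMin m 0 μ 0 ⊤).closure = (diracMin m 0 μ 0 punctured).closure :=
  LinearPMap.closure_eq_of_le_of_symmetric (dense_diracMin_punctured m μ)
    (isClosable_diracMin_punctured m μ) (isSelfAdjoint_closure_diracMin_punctured m μ)
    (diracMin_punctured_le m 0 μ 0) (diracMin_isFormalAdjoint m μ ⊤)

/-- The maximal operator is the adjoint of the minimal one, as far as domains go. -/
theorem diracMax_domain_eq_adjoint_domain {m ν μ lam : ℝ}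
    (hd : Dense ((diracMin m ν μ lam ⊤).domain : Set L2)) :
    (diracMax m ν μ lam).domain = (diracMin m ν μ lam ⊤).adjoint.domain := by
  refine le_antisymm ?_ fun ψ hψ ↦ ?_
  · rintro ψ ⟨η, h⟩
    rw [isDistribDirac_iff] at h
    refine LinearPMap.mem_adjoint_domain_of_exists _ ⟨η, forall_diracMin_domain.2 fun φ ↦ ?_⟩
    rw [diracMin_apply, ← inner_conj_symm, ← h, inner_conj_symm]
  · refine ⟨(diracMin m ν μ lam ⊤).adjoint ⟨ψ, hψ⟩, isDistribDirac_iff.2 fun φ ↦ ?_⟩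
    have := (LinearPMap.adjoint_isFormalAdjoint hd).symm
      ⟨testToL2 ⊤ φ, mem_diracMin_domain m ν μ lam φ⟩ ⟨ψ, hψ⟩
    rwa [diracMin_apply] at this

end DiracOp

end

theorem mainTheorem6 (m μ : ℝ) :
    -- `H` is essentially self-adjoint on `C_c^∞(ℝ³ ∖ {0})⁴`
    DiracOp.IsEssentiallySelfAdjoint (DiracOp.diracMin m 0 μ 0 DiracOp.punctured) ∧
    -- the closures of `H` on `C_c^∞(ℝ³ ∖ {0})⁴` and on `C_c^∞(ℝ³)⁴` have the maximal domain
    (DiracOp.diracMin m 0 μ 0 DiracOp.punctured).closure.domain =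
      (DiracOp.diracMax m 0 μ 0).domain ∧
    DiracOp.IsEssentiallySelfAdjoint (DiracOp.diracMin m 0 μ 0 ⊤) ∧
    (DiracOp.diracMin m 0 μ 0 ⊤).closure.domain = (DiracOp.diracMax m 0 μ 0).domain ∧
    -- and the maximal domain is `H¹(ℝ³)⁴`
    (DiracOp.diracMax m 0 μ 0).domain = DiracOp.sobolevH1 := by
  have hd := DiracOp.dense_diracMin_punctured m μ
  have hdt : Dense ((DiracOp.diracMin m 0 μ 0 ⊤).domain : Set DiracOp.L2) :=
    hd.mono (DiracOp.diracMin_punctured_le m 0 μ 0).1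
  have hs := DiracOp.diracMin_isFormalAdjoint m μ
  have hc := DiracOp.isClosable_diracMin_punctured m μ
  have hct := LinearPMap.isClosable_of_symmetric hdt (hs ⊤)
  have hsa := DiracOp.isSelfAdjoint_closure_diracMin_punctured m μ
  have hcl := DiracOp.diracMin_top_closure m μ
  have hH1 := DiracOp.diracMin_punctured_closure_domain m μ
  have hmax : (DiracOp.diracMax m 0 μ 0).domain = DiracOp.sobolevH1 := by
    rw [DiracOp.diracMax_domain_eq_adjoint_domain hdt,
      LinearPMap.adjoint_eq_closure_of_isSelfAdjoint_closure hdt hct (hcl ▸ hsa), hcl, hH1]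
  exact ⟨⟨hd, hs _, hc, hsa⟩, hH1.trans hmax.symm, ⟨hdt, hs _, hct, hcl ▸ hsa⟩,
    by rw [hcl, hH1, hmax], hmax⟩
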